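/- Let $R$ be a commutative Artinian ring and let $\Lambda$ and $\Gamma$ be Artin $R$-algebras, i.e. $R$-algebras that are finitely generated as $R$-modules. Modules are left modules. Two rings $A$ and $B$ are called symmetrically separably equivalent if there are bimodules ${}_AM_B$ and ${}_BN_A$, each finitely generated projective as a left module and as a right module, and bimodules ${}_AX_A$, ${}_BY_B$ with bimodule isomorphisms $M\otimes_B N\cong A\oplus X$ and $N\otimes_A M\cong B\oplus Y$, such that both $(M\otimes_B-,\,N\otimes_A-)$ and $(N\otimes_A-,\,M\otimes_B-)$ are adjoint pairs of functors between the categories of all modules. Let $D=\mathrm{Hom}_R(-,E)$, where $E$ is the injective envelope of $R/\mathrm{rad}\,R$, and let $\nu_\Lambda=D\,\mathrm{Hom}_\Lambda(-,\Lambda)$ be the Nakayama functor. A finitely generated projective $\Lambda$-module $P$ is $\nu$-stable projective if $\nu_\Lambda^i(P)$ is projective for all $i\ge 1$; $\Lambda\text{-stp}$ denotes the class of these modules. A Frobenius part of $\Lambda$ is the endomorphism algebra $\mathrm{End}_\Lambda(V)$ of a finitely generated $\Lambda$-module $V$ with $\mathrm{add}\,V=\Lambda\text{-stp}$, where $\mathrm{add}\,V$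 is the class of modules isomorphic to direct summands of finite direct sums of copies of $V$, and endomorphisms act on $V$ from the right. $\Lambda$ is Frobenius-finite if it has a Frobenius part that is representation-finite, i.e. has only finitely many isomorphism classes of finitely generated indecomposable modules. The same terms are used for $\Gamma$. **Theorem 3.4.** Suppose that $\Lambda$ and $\Gamma$ are symmetrically separably equivalent. Then: (1) $\Lambda$ and $\Gamma$ have Frobenius parts, and every Frobenius part of $\Lambda$ is symmetrically separably equivalent to every Frobenius part of $\Gamma$. If the equivalence between $\Lambda$ and $\Gamma$ can be defined by bimodules on which $R$ acts centrally ($rm=mr$), then so can the one between the Frobenius parts. (2) $\Lambda$ is Frobenius-finite if and only if $\Gamma$ is Frobenius-finite. -/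

import Mathlib

open CategoryTheory MulOpposite
open scoped TensorProduct

universe u

namespace SepEq

/-! ### Bimodules and tensor products over noncommutative rings -/

/-- A `Λ`-`Γ`-bimodule: a left `Λ`-module and right `Γ`-module (that is, a module over the
opposite ring `Γᵐᵒᵖ`) whose two actions commute. -/
structure Bimodule (Λ Γ : Type u) [Ring Λ] [Ring Γ] where
  carrier : Type u
  [addCommGroup : AddCommGroup carrier]
  [leftModule : Module Λ carrier]
  [rightModule : Module Γᵐᵒᵖ carrier]
  [smulComm : SMulCommClass Λ Γᵐᵒᵖ carrier]

instance {Λ Γ : Type u} [Ring Λ] [Ring Γ] : CoeSort (Bimodule Λ Γ) (Type u) :=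
  ⟨Bimodule.carrier⟩

attribute [instance] Bimodule.addCommGroup Bimodule.leftModule Bimodule.rightModule
  Bimodule.smulComm

section RingTensor

variable (Γ : Type u) [Ring Γ]

/-- The relations `m g ⊗ n = m ⊗ g n` in `M ⊗_ℤ N`. -/
def balancedRel (M N : Type u) [AddCommGroup M] [AddCommGroup N] [Module Γᵐᵒᵖ M] [Module Γ N] :
    AddSubgroup (M ⊗[ℤ] N) :=
  AddSubgroup.closure
    {t | ∃ (m : M) (g : Γ) (n : N), t = (op g • m) ⊗ₜ[ℤ] n - m ⊗ₜ[ℤ] (g • n)}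

/-- The tensor product `M ⊗_Γ N` of a right `Γ`-module and a left `Γ`-module, as an abelian
group. -/
def RingTensor (M N : Type u) [AddCommGroup M] [AddCommGroup N] [Module Γᵐᵒᵖ M] [Module Γ N] :
    Type u :=
  (M ⊗[ℤ] N) ⧸ balancedRel Γ M N

namespace RingTensor

variable {M M' M'' N N' N'' : Type u}
  [AddCommGroup M] [AddCommGroup M'] [AddCommGroup M'']
  [AddCommGroup N] [AddCommGroup N'] [AddCommGroup N'']
  [Module Γᵐᵒᵖ M] [Module Γᵐᵒᵖ M'] [Module Γᵐᵒᵖ M'']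
  [Module Γ N] [Module Γ N'] [Module Γ N'']

instance : AddCommGroup (RingTensor Γ M N) :=
  inferInstanceAs (AddCommGroup ((M ⊗[ℤ] N) ⧸ balancedRel Γ M N))

/-- The pure tensor `m ⊗ n` in `M ⊗_Γ N`. -/
def tmul (m : M) (n : N) : RingTensor Γ M N :=
  QuotientAddGroup.mk' (balancedRel Γ M N) (m ⊗ₜ[ℤ] n)

theorem add_tmul (m m' : M) (n : N) : tmul Γ (m + m') n = tmul Γ m n + tmul Γ m' n :=
  congrArg (QuotientAddGroup.mk' (balancedRel Γ M N)) (TensorProduct.add_tmul m m' n)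

theorem tmul_add (m : M) (n n' : N) : tmul Γ m (n + n') = tmul Γ m n + tmul Γ m n' :=
  congrArg (QuotientAddGroup.mk' (balancedRel Γ M N)) (TensorProduct.tmul_add m n n')

theorem zero_tmul (n : N) : tmul Γ (0 : M) n = 0 :=
  congrArg (QuotientAddGroup.mk' (balancedRel Γ M N)) (TensorProduct.zero_tmul M n)

theorem tmul_zero (m : M) : tmul Γ m (0 : N) = 0 :=
  congrArg (QuotientAddGroup.mk' (balancedRel Γ M N)) (TensorProduct.tmul_zero N m)

/-- Additive maps out of `M ⊗_Γ N` that agree on pure tensors are equal. -/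
theorem hom_ext {A : Type*} [AddCommGroup A] {f g : RingTensor Γ M N →+ A}
    (h : ∀ m n, f (tmul Γ m n) = g (tmul Γ m n)) : f = g :=
  QuotientAddGroup.addMonoidHom_ext (balancedRel Γ M N) <| AddMonoidHom.ext fun t => by
    induction t with
    | zero => rw [map_zero, map_zero]
    | tmul m n => exact h m n
    | add x y hx hy => rw [map_add, map_add, hx, hy]

/-- The additive map `f ⊗ g : M ⊗_Γ N → M' ⊗_Γ N'` for a map `f` of right modules and a map `g`
of left modules. -/
def map (f : M →ₗ[Γᵐᵒᵖ] M') (g : N →ₗ[Γ] N') : RingTensor Γ M N →+ RingTensor Γ M' N' :=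
  QuotientAddGroup.map (balancedRel Γ M N) (balancedRel Γ M' N')
    (TensorProduct.map f.toAddMonoidHom.toIntLinearMap
      g.toAddMonoidHom.toIntLinearMap).toAddMonoidHom <| by
      refine (AddSubgroup.closure_le _).2 ?_
      rintro _ ⟨m, a, n, rfl⟩
      refine AddSubgroup.subset_closure ⟨f m, a, g n, ?_⟩
      refine (map_sub _ _ _).trans ?_
      change f (op a • m) ⊗ₜ[ℤ] g n - f m ⊗ₜ[ℤ] g (a • n) = _
      rw [map_smul, map_smul]

@[simp] theorem map_tmul (f : M →ₗ[Γᵐᵒᵖ] M') (g : N →ₗ[Γ] N') (m : M) (n : N) :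
    map Γ f g (tmul Γ m n) = tmul Γ (f m) (g n) := rfl

theorem map_id :
    map Γ (LinearMap.id : M →ₗ[Γᵐᵒᵖ] M) (LinearMap.id : N →ₗ[Γ] N) = AddMonoidHom.id _ :=
  hom_ext Γ fun _ _ => rfl

theorem map_comp (f : M →ₗ[Γᵐᵒᵖ] M') (f' : M' →ₗ[Γᵐᵒᵖ] M'') (g : N →ₗ[Γ] N')
    (g' : N' →ₗ[Γ] N'') :
    map Γ (f' ∘ₗ f) (g' ∘ₗ g) = (map Γ f' g').comp (map Γ f g) :=
  hom_ext Γ fun _ _ => rfl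

variable (M N)

/-- Endomorphisms of the right module `M` act on `M ⊗_Γ N`. -/
def leftEnd : Module.End Γᵐᵒᵖ M →+* AddMonoid.End (RingTensor Γ M N) where
  toFun f := map Γ f LinearMap.id
  map_one' := map_id Γ
  map_mul' f f' := map_comp Γ f' f LinearMap.id LinearMap.id
  map_zero' := hom_ext Γ fun _ n => zero_tmul Γ n
  map_add' f f' := hom_ext Γ fun m n => add_tmul Γ (f m) (f' m) n

/-- Endomorphisms of the left module `N` act on `M ⊗_Γ N`. -/
def rightEnd : Module.End Γ N →+* AddMonoid.End (RingTensor Γ M N) where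
  toFun g := map Γ LinearMap.id g
  map_one' := map_id Γ
  map_mul' g g' := map_comp Γ LinearMap.id LinearMap.id g' g
  map_zero' := hom_ext Γ fun m _ => tmul_zero Γ m
  map_add' g g' := hom_ext Γ fun m n => tmul_add Γ m (g n) (g' n)

/-- An action of a ring on `M` commuting with that of `Γ` induces one on `M ⊗_Γ N`,
by `a (m ⊗ n) = (a m) ⊗ n`. (Not an instance, to avoid clashes with the action through `N`.) -/
abbrev actLeft (A : Type u) [Ring A] [Module A M] [SMulCommClass A Γᵐᵒᵖ M] :
    Module A (RingTensor Γ M N) :=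
  Module.compHom _ ((leftEnd Γ M N).comp (Module.toModuleEnd Γᵐᵒᵖ (S := A) M))

/-- A right action of a ring on `N` commuting with that of `Γ` induces one on `M ⊗_Γ N`,
by `(m ⊗ n) b = m ⊗ (n b)`. -/
abbrev actRight (B : Type u) [Ring B] [Module Bᵐᵒᵖ N] [SMulCommClass Γ Bᵐᵒᵖ N] :
    Module Bᵐᵒᵖ (RingTensor Γ M N) :=
  haveI := SMulCommClass.symm Γ Bᵐᵒᵖ N
  Module.compHom _ ((rightEnd Γ M N).comp (Module.toModuleEnd Γ (S := Bᵐᵒᵖ) N))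

end RingTensor

end RingTensor

namespace Bimodule

variable {Λ Γ Δ : Type u} [Ring Λ] [Ring Γ] [Ring Δ]

/-- The regular bimodule `Λ`. -/
def self (Λ : Type u) [Ring Λ] : Bimodule Λ Λ := { carrier := Λ }

/-- The direct sum of two bimodules. -/
def prod (M M' : Bimodule Λ Γ) : Bimodule Λ Γ := { carrier := M × M' }

/-- The bimodule `M ⊗_Γ N`, with `a (m ⊗ n) b = (a m) ⊗ (n b)`. -/
def tensor (M : Bimodule Λ Γ) (N : Bimodule Γ Δ) : Bimodule Λ Δ :=
  letI := RingTensor.actLeft Γ M N Λ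
  letI := RingTensor.actRight Γ M N Δ
  { carrier := RingTensor Γ M N
    smulComm := ⟨fun a b t => by
      have := SMulCommClass.symm Γ Δᵐᵒᵖ N
      have h : (RingTensor.leftEnd Γ M N (Module.toModuleEnd Γᵐᵒᵖ (S := Λ) M a)).comp
          (RingTensor.rightEnd Γ M N (Module.toModuleEnd Γ (S := Δᵐᵒᵖ) N b)) =
          (RingTensor.rightEnd Γ M N (Module.toModuleEnd Γ (S := Δᵐᵒᵖ) N b)).comp
          (RingTensor.leftEnd Γ M N (Module.toModuleEnd Γᵐᵒᵖ (S := Λ) M a)) :=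
        RingTensor.hom_ext Γ fun _ _ => rfl
      exact DFunLike.congr_fun h t⟩ }

/-- Two bimodules are isomorphic: there is a bijection that is linear for both actions. -/
def IsIsomorphic (M M' : Bimodule Λ Γ) : Prop :=
  ∃ e : M ≃ₗ[Λ] M', ∀ (g : Γᵐᵒᵖ) (m : M), e (g • m) = g • e m

/-- The left `Λ`-module `M ⊗_Γ V` for a `Λ`-`Γ`-bimodule `M` and a left `Γ`-module `V`. -/
def TensorObj (M : Bimodule Λ Γ) (V : Type u) [AddCommGroup V] [Module Γ V] : Type u :=
  RingTensor Γ M V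

instance (M : Bimodule Λ Γ) (V : Type u) [AddCommGroup V] [Module Γ V] :
    AddCommGroup (M.TensorObj V) :=
  inferInstanceAs (AddCommGroup (RingTensor Γ M V))

instance (M : Bimodule Λ Γ) (V : Type u) [AddCommGroup V] [Module Γ V] :
    Module Λ (M.TensorObj V) :=
  RingTensor.actLeft Γ M V Λ

/-- The map `M ⊗_Γ f`. -/
def tensorMap (M : Bimodule Λ Γ) {V W : Type u} [AddCommGroup V] [Module Γ V] [AddCommGroup W]
    [Module Γ W] (f : V →ₗ[Γ] W) : M.TensorObj V →ₗ[Λ] M.TensorObj W where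
  toFun := RingTensor.map Γ LinearMap.id f
  map_add' := map_add (RingTensor.map Γ (LinearMap.id : M →ₗ[Γᵐᵒᵖ] M) f)
  map_smul' a t := by
    have h : (RingTensor.map Γ LinearMap.id f).comp
        (RingTensor.leftEnd Γ M V (Module.toModuleEnd Γᵐᵒᵖ (S := Λ) M a)) =
        (RingTensor.leftEnd Γ M W (Module.toModuleEnd Γᵐᵒᵖ (S := Λ) M a)).comp
        (RingTensor.map Γ LinearMap.id f) :=
      RingTensor.hom_ext Γ fun _ _ => rfl
    exact DFunLike.congr_fun h t

/-- The functor `M ⊗_Γ - : Mod Γ ⥤ Mod Λ` of a `Λ`-`Γ`-bimodule `M`. -/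
def tensorFunctor (M : Bimodule Λ Γ) : ModuleCat.{u} Γ ⥤ ModuleCat.{u} Λ where
  obj V := ModuleCat.of Λ (M.TensorObj V)
  map f := ModuleCat.ofHom (M.tensorMap f.hom)
  map_id V := ModuleCat.hom_ext <| LinearMap.ext fun t =>
    DFunLike.congr_fun (RingTensor.map_id Γ (M := M) (N := V)) t
  map_comp f g := ModuleCat.hom_ext <| LinearMap.ext fun t =>
    DFunLike.congr_fun (RingTensor.map_comp Γ (LinearMap.id : M →ₗ[Γᵐᵒᵖ] M)
      LinearMap.id f.hom g.hom) t

/-- Finitely generated projective as a left module and as a right module. -/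
def FGProjectiveOneSided (M : Bimodule Λ Γ) : Prop :=
  (Module.Finite Λ M ∧ Module.Projective Λ M) ∧
    (Module.Finite Γᵐᵒᵖ M ∧ Module.Projective Γᵐᵒᵖ M)

/-- The commutative ring `R` acts in the same way from the left and from the right. -/
def IsCentralOver (R : Type*) [CommRing R] [Algebra R Λ] [Algebra R Γ] (M : Bimodule Λ Γ) :
    Prop :=
  ∀ (r : R) (m : M), algebraMap R Λ r • m = op (algebraMap R Γ r) • m

end Bimodule

/-! ### Symmetrical separable equivalence -/

/-- The bimodules `M` and `N` define a symmetrical separable equivalence of `Λ` and `Γ`. -/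
structure DefineSymmSepEquiv {Λ Γ : Type u} [Ring Λ] [Ring Γ]
    (M : Bimodule Λ Γ) (N : Bimodule Γ Λ) : Prop where
  fgProj_left : M.FGProjectiveOneSided
  fgProj_right : N.FGProjectiveOneSided
  split_left : ∃ X : Bimodule Λ Λ, (M.tensor N).IsIsomorphic ((Bimodule.self Λ).prod X)
  split_right : ∃ Y : Bimodule Γ Γ, (N.tensor M).IsIsomorphic ((Bimodule.self Γ).prod Y)
  adj : Nonempty (M.tensorFunctor ⊣ N.tensorFunctor)
  adj' : Nonempty (N.tensorFunctor ⊣ M.tensorFunctor)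

/-- The rings `Λ` and `Γ` are symmetrically separably equivalent. -/
def SymmSepEquiv (Λ Γ : Type u) [Ring Λ] [Ring Γ] : Prop :=
  ∃ (M : Bimodule Λ Γ) (N : Bimodule Γ Λ), DefineSymmSepEquiv M N

/-- The `R`-algebras `Λ` and `Γ` are symmetrically separably equivalent through bimodules on
which `R` acts centrally. -/
def SymmSepEquivOver (R : Type*) [CommRing R] (Λ Γ : Type u) [Ring Λ] [Ring Γ]
    [Algebra R Λ] [Algebra R Γ] : Prop :=
  ∃ (M : Bimodule Λ Γ) (N : Bimodule Γ Λ),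
    DefineSymmSepEquiv M N ∧ M.IsCentralOver R ∧ N.IsCentralOver R

/-! ### The injective envelope of `R / rad R` -/

section Envelope

variable (R : Type u) [CommRing R]

/-- `E` is an injective envelope of `S`: it is injective and contains a copy of `S` that meets
every nonzero submodule of `E`. -/
def IsInjectiveEnvelope (S E : Type u) [AddCommGroup S] [Module R S] [AddCommGroup E]
    [Module R E] : Prop :=
  Module.Injective R E ∧ ∃ ι : S →ₗ[R] E, Function.Injective ι ∧
    ∀ p : Submodule R E, p ⊓ LinearMap.range ι = ⊥ → p = ⊥

theorem exists_injectiveEnvelope (S : Type u) [AddCommGroup S] [Module R S] :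
    ∃ E : ModuleCat.{u} R, IsInjectiveEnvelope R S E := by
  classical
  obtain ⟨⟨I, hI, i, hi⟩⟩ := EnoughInjectives.presentation (ModuleCat.of R S)
  have hI' : Module.Injective R I := (Module.injective_iff_injective_object R I).2 hI
  have hinj : Function.Injective i.hom := (ModuleCat.mono_iff_injective i).1 hi
  set T : Submodule R I := LinearMap.range i.hom with hT
  -- a maximal essential extension `E` of `T` inside `I`
  obtain ⟨E, -, ⟨hTE, hess⟩, hmax⟩ := zorn_le_nonempty₀
    {E : Submodule R I | T ≤ E ∧ ∀ p ≤ E, p ⊓ T = ⊥ → p = ⊥}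
    (fun c hc hchain y hy => by
      refine ⟨sSup c, ⟨(hc hy).1.trans (le_sSup hy), fun p hp hpT => ?_⟩, fun z hz => le_sSup hz⟩
      refine (Submodule.eq_bot_iff _).2 fun x hx => ?_
      obtain ⟨F, hF, hxF⟩ := (Submodule.mem_sSup_of_directed ⟨y, hy⟩ hchain.directedOn).1 (hp hx)
      have h1 := (hc hF).2 (Submodule.span R {x})
        ((Submodule.span_singleton_le_iff_mem _ _).2 hxF)
        (le_bot_iff.1 (hpT ▸ inf_le_inf_right T
          ((Submodule.span_singleton_le_iff_mem _ _).2 hx)))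
      exact Submodule.span_singleton_eq_bot.1 h1)
    T ⟨le_rfl, fun p hp h => by rwa [inf_eq_left.2 hp] at h⟩
  -- a maximal submodule `C` disjoint from `E`
  obtain ⟨C, -, hC, hCmax⟩ := zorn_le_nonempty₀ {C : Submodule R I | C ⊓ E = ⊥}
    (fun c hc hchain y hy => by
      refine ⟨sSup c, (Submodule.eq_bot_iff _).2 fun x hx => ?_, fun z hz => le_sSup hz⟩
      obtain ⟨F, hF, hxF⟩ := (Submodule.mem_sSup_of_directed ⟨y, hy⟩ hchain.directedOn).1 hx.1
      exact (Submodule.eq_bot_iff _).1 (hc hF) x ⟨hxF, hx.2⟩)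
    ⊥ (bot_inf_eq E)
  obtain ⟨g, hg⟩ := hI'.out (C.mkQ ∘ₗ E.subtype)
    (LinearMap.ker_eq_bot.1 <| (Submodule.eq_bot_iff _).2 fun x hx =>
      Subtype.ext ((Submodule.eq_bot_iff _).1 hC x
        ⟨(Submodule.Quotient.mk_eq_zero C).1 hx, x.2⟩)) E.subtype
  let r : I →ₗ[R] I := g ∘ₗ C.mkQ
  have hrE : ∀ x ∈ E, r x = x := fun x hx => hg ⟨x, hx⟩
  have hCr : C ≤ LinearMap.ker r := fun x hx => by
    have : C.mkQ x = 0 := (Submodule.Quotient.mk_eq_zero C).2 hx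
    simp [r, LinearMap.comp_apply, -Submodule.mkQ_apply, this]
  have hrange : LinearMap.range r ≤ E := by
    refine hmax ⟨hTE.trans fun x hx => ⟨x, hrE x hx⟩, fun p hp hpT => ?_⟩
      fun x hx => ⟨x, hrE x hx⟩
    have hpE : p ⊓ E = ⊥ := hess _ inf_le_right
      (le_bot_iff.1 (hpT ▸ inf_le_inf_right T inf_le_left))
    have hq : p.comap r ≤ C := by
      refine hCmax ((Submodule.eq_bot_iff _).2 fun x hx => ?_) fun x hx => ?_
      · exact (Submodule.eq_bot_iff _).1 hpE x ⟨by simpa [hrE x hx.2] using hx.1, hx.2⟩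
      · simp [LinearMap.mem_ker.1 (hCr hx)]
    refine (Submodule.eq_bot_iff _).2 fun y hy => ?_
    obtain ⟨x, rfl⟩ := hp hy
    exact LinearMap.mem_ker.1 (hCr (hq hy))
  refine ⟨ModuleCat.of R E, ⟨fun X Y _ _ _ _ f hf k => ?_⟩, i.hom.codRestrict E
    fun x => hTE ⟨x, rfl⟩, fun x y hxy => hinj (congrArg Subtype.val hxy), fun p hp => ?_⟩
  · obtain ⟨k', hk'⟩ := hI'.out f hf (E.subtype ∘ₗ k)
    refine ⟨(r.codRestrict E fun x => hrange ⟨x, rfl⟩) ∘ₗ k', fun x => Subtype.ext ?_⟩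
    change r (k' (f x)) = k x
    rw [hk']
    exact hrE _ (k x).2
  · have h1 : p.map E.subtype = ⊥ := by
      refine hess _ (Submodule.map_subtype_le E p) ((Submodule.eq_bot_iff _).2 ?_)
      rintro _ ⟨⟨x, hx, rfl⟩, ⟨s, hs⟩⟩
      have : x = 0 := (Submodule.eq_bot_iff _).1 hp x ⟨hx, s, Subtype.ext hs⟩
      simp [this]
    exact Submodule.map_injective_of_injective E.injective_subtype (h1.trans (Submodule.map_bot _).symm)

/-- The injective envelope of `R / rad R`. -/
noncomputable def dualizingModule : ModuleCat.{u} R :=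
  (exists_injectiveEnvelope R (R ⧸ Ring.jacobson R)).choose

end Envelope

/-! ### The Nakayama functor and `ν`-stable projective modules -/

section Nakayama

variable (R : Type u) [CommRing R] {Λ : Type u} [Ring Λ] [Algebra R Λ]

/-- The underlying group of `ν(P) = D Hom_Λ(P, Λ)`, where `D = Hom_R(-, E(R / rad R))`. -/
def NakayamaCarrier (P : Type u) [AddCommGroup P] [Module Λ P] : Type u :=
  (P →ₗ[Λ] Λ) →ₗ[R] dualizingModule R

noncomputable instance (P : Type u) [AddCommGroup P] [Module Λ P] :
    AddCommGroup (NakayamaCarrier R (Λ := Λ) P) :=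
  inferInstanceAs (AddCommGroup ((P →ₗ[Λ] Λ) →ₗ[R] dualizingModule R))

/-- Right multiplication by `a` on the right `Λ`-module `Hom_Λ(P, Λ)`: `(f a)(p) = f(p) a`. -/
def rightMul (P : Type u) [AddCommGroup P] [Module Λ P] (a : Λ) :
    (P →ₗ[Λ] Λ) →ₗ[R] (P →ₗ[Λ] Λ) where
  toFun f := op a • f
  map_add' := smul_add _
  map_smul' r f := by
    ext p
    simp

/-- The left `Λ`-module structure on `ν(P)`: `(a φ)(f) = φ(f a)`. -/
noncomputable instance (P : Type u) [AddCommGroup P] [Module Λ P] :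
    Module Λ (NakayamaCarrier R (Λ := Λ) P) where
  smul a φ := LinearMap.comp (φ : (P →ₗ[Λ] Λ) →ₗ[R] dualizingModule R) (rightMul R P a)
  one_smul φ := LinearMap.ext fun f => congrArg φ.toFun (LinearMap.ext fun p => mul_one (f p))
  mul_smul a b φ := LinearMap.ext fun f =>
    congrArg φ.toFun (LinearMap.ext fun p => (mul_assoc (f p) a b).symm)
  smul_zero _ := LinearMap.zero_comp _
  smul_add _ _ _ := LinearMap.add_comp _ _ _
  add_smul a b φ := LinearMap.ext fun f =>
    (congrArg φ.toFun (LinearMap.ext fun p => mul_add (f p) a b)).trans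
      (φ.map_add' _ _)
  zero_smul φ := LinearMap.ext fun f =>
    (congrArg φ.toFun (LinearMap.ext fun p => mul_zero (f p))).trans (LinearMap.map_zero φ)

/-- The Nakayama functor `ν = D Hom_Λ(-, Λ)` on objects. -/
noncomputable def nakayama (P : ModuleCat.{u} Λ) : ModuleCat.{u} Λ :=
  ModuleCat.of Λ (NakayamaCarrier R (Λ := Λ) P)

/-- `P` is a (finitely generated) `ν`-stable projective module: `P` is projective, and so is
`νⁱ(P)` for every `i ≥ 1`. -/
def IsNuStableProjective (P : ModuleCat.{u} Λ) : Prop :=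
  Module.Finite Λ P ∧ Module.Projective Λ P ∧
    ∀ i : ℕ, 1 ≤ i → Module.Projective Λ ((nakayama R)^[i] P : ModuleCat.{u} Λ)

end Nakayama

/-! ### Frobenius parts -/

/-- `X` belongs to `add V`: it is isomorphic to a direct summand of a finite direct sum of copies
of `V`, that is, the identity of `X` factors through such a sum. -/
def InAdd (Λ : Type u) [Ring Λ] (V X : Type u) [AddCommGroup V] [Module Λ V]
    [AddCommGroup X] [Module Λ X] : Prop :=
  ∃ (n : ℕ) (i : X →ₗ[Λ] (Fin n → V)) (p : (Fin n → V) →ₗ[Λ] X), p ∘ₗ i = LinearMap.id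

/-- `V` is a finitely generated module with `add V = Λ-stp`, the class of `ν`-stable projective
modules. -/
def IsStpGenerator (R : Type u) [CommRing R] (Λ : Type u) [Ring Λ] [Algebra R Λ]
    (V : Type u) [AddCommGroup V] [Module Λ V] : Prop :=
  Module.Finite Λ V ∧ ∀ X : ModuleCat.{u} Λ, IsNuStableProjective R X ↔ InAdd Λ V X

/-- The endomorphism algebra of a left module, with endomorphisms acting from the right (the
product is `f * g = g ∘ f`), so that `V` is a `Λ`-`End(V)`-bimodule and `End(Λ) = Λ`. If `V` is a
module with `add V = Λ-stp`, then this is the Frobenius part of `Λ`. -/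
abbrev EndAlg (Λ : Type u) [Ring Λ] (V : Type u) [AddCommGroup V] [Module Λ V] : Type u :=
  (Module.End Λ V)ᵐᵒᵖ

/-- An indecomposable module: nonzero, with no nontrivial direct sum decomposition. -/
def IsIndecomposable (A : Type u) [Ring A] (X : Type u) [AddCommGroup X] [Module A X] : Prop :=
  Nontrivial X ∧ ∀ p q : Submodule A X, IsCompl p q → p = ⊥ ∨ q = ⊥

/-- There are only finitely many isomorphism classes of finitely generated indecomposable
left modules. -/
def IsRepresentationFinite (A : Type u) [Ring A] : Prop :=
  ∃ (n : ℕ) (Y : Fin n → ModuleCat.{u} A), ∀ X : ModuleCat.{u} A,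
    Module.Finite A X → IsIndecomposable A X → ∃ i, Nonempty (X ≃ₗ[A] Y i)

/-- The Artin `R`-algebra `Λ` is Frobenius-finite: its Frobenius part is representation-finite. -/
def IsFrobeniusFinite (R : Type u) [CommRing R] (Λ : Type u) [Ring Λ] [Algebra R Λ] : Prop :=
  ∃ V : ModuleCat.{u} Λ, IsStpGenerator R Λ V ∧ IsRepresentationFinite (EndAlg Λ V)

end SepEq

/-!
The definition of a `ν`-stable projective module involves the base ring `R` through the Nakayama
functor, whereas a symmetrical separable equivalence knows nothing about `R`. The proof therefore
starts from a description of `Λ-stp` in terms of the category of `Λ`-modules alone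
(`isNuStableProjective_iff`): `P` is `ν`-stable projective if and only if it lies in `add Q` for a
*balanced* module `Q` (`IsBalanced`), that is, a finitely generated projective-injective module with
`Hom(Q, X) ≠ 0 ↔ Hom(X, Q) ≠ 0` for all `X`. Both directions rest on the duality
`Hom(X, ν P) ≅ D Hom(P, X)`: it makes `ν P` injective, and makes the socle of `ν P` the top of `P`.
If `Q` is balanced, then for `P` in `add Q` the socle of `ν P` consists of simple submodules of `Q`,
so `ν P` is in `add Q` again. Conversely, for `ν`-stable projective `P` put
`Q = ν P ⊕ ⋯ ⊕ νⁿ P`. For large `n` the simple submodules of `Q` are the simple quotients of all the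
`νⁱ P` with `i ≥ 0`, hence include the simple quotients of `Q`; but a projective-injective module
has at least as many simple quotients as simple submodules (`exists_injective_socle_to_top`), so the
two sets agree. A finite direct sum of balanced modules is a generator of `Λ-stp`
(`exists_isStpGenerator`).

Balanced modules are clearly preserved by a functor with the same left and right adjoint
(`IsBalanced.map`), so `M ⊗ -` and `N ⊗ -` restrict to functors between `Γ-stp` and `Λ-stp`.
For generators `V` of `Λ-stp` and `W` of `Γ-stp`, the bimodules between the two endomorphism algebras
are `Hom(V, M ⊗ W)` and `Hom(W, N ⊗ V)`. Since `M ⊗ W` is in `add V`, the unit and the counit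
of `M ⊗ - ⊣ N ⊗ -` provide these bimodules with a pairing and a dual basis (`nonempty_dualBasis`);
a dual basis implies projectivity and adjointness of the tensor functors
(`Bimodule.DualBasis.adjunction`). That `Λ` is a summand of `M ⊗ N` says that the identity is a
natural summand of `M ⊗ (N ⊗ -)`, and evaluating this at `V` splits `End(V)` off
`Hom(V, M ⊗ W) ⊗ Hom(W, N ⊗ V)` (`exists_homBimodule_split`).

Finally, representation-finiteness passes along a symmetrical separable equivalence of Artinian
rings: an indecomposable `Z` is a summand of `N ⊗ (M ⊗ Z)`, hence, by Krull–Schmidt, of one of the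
finitely many modules `N ⊗ U` with `U` indecomposable.
-/

namespace SepEq

/-! ### Modules in `add V` -/

section Add

variable {Λ : Type u} [Ring Λ] {V X Y : Type u} [AddCommGroup V] [Module Λ V]
  [AddCommGroup X] [Module Λ X] [AddCommGroup Y] [Module Λ Y]

theorem InAdd.of_sum {ι : Type*} [Fintype ι] (a : ι → X →ₗ[Λ] V) (b : ι → V →ₗ[Λ] X)
    (h : ∑ k, b k ∘ₗ a k = LinearMap.id) : InAdd Λ V X := by
  let e := Fintype.equivFin ι
  refine ⟨Fintype.card ι, LinearMap.pi fun k => a (e.symm k),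
    LinearMap.lsum Λ _ ℕ fun k => b (e.symm k), ?_⟩
  rw [← h]
  ext x
  simp only [LinearMap.comp_apply, LinearMap.lsum_apply, LinearMap.sum_apply, LinearMap.proj_apply,
    LinearMap.pi_apply]
  exact e.symm.sum_comp fun k => b k (a k x)

theorem InAdd.exists_sum (h : InAdd Λ V X) :
    ∃ (n : ℕ) (a : Fin n → X →ₗ[Λ] V) (b : Fin n → V →ₗ[Λ] X),
      ∑ k, b k ∘ₗ a k = LinearMap.id := by
  obtain ⟨n, i, p, hip⟩ := h
  refine ⟨n, fun k => LinearMap.proj k ∘ₗ i, fun k => p ∘ₗ LinearMap.single Λ (fun _ => V) k, ?_⟩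
  ext x
  have hx : i x = ∑ k, Pi.single k (i x k) := (Finset.univ_sum_single (i x)).symm
  have := congrArg p hx
  rw [← LinearMap.comp_apply, hip, map_sum] at this
  simpa using this.symm

theorem InAdd.of_retract (i : X →ₗ[Λ] V) (p : V →ₗ[Λ] X) (h : p ∘ₗ i = LinearMap.id) :
    InAdd Λ V X :=
  InAdd.of_sum (ι := Unit) (fun _ => i) (fun _ => p) (by simpa using h)

theorem InAdd.refl : InAdd Λ V V := InAdd.of_retract LinearMap.id LinearMap.id rfl

theorem InAdd.trans (h : InAdd Λ V X) (h' : InAdd Λ X Y) : InAdd Λ V Y := by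
  obtain ⟨n, a, b, hab⟩ := h.exists_sum
  obtain ⟨m, c, d, hcd⟩ := h'.exists_sum
  refine InAdd.of_sum (ι := Fin m × Fin n) (fun k => a k.2 ∘ₗ c k.1) (fun k => d k.1 ∘ₗ b k.2) ?_
  rw [Fintype.sum_prod_type, ← hcd]
  refine Finset.sum_congr rfl fun j _ => ?_
  ext x
  have := congrArg (d j) (LinearMap.congr_fun hab (c j x))
  simpa [LinearMap.sum_apply] using this

theorem InAdd.finite [Module.Finite Λ V] (h : InAdd Λ V X) : Module.Finite Λ X := by
  obtain ⟨n, i, p, hip⟩ := h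
  exact Module.Finite.of_surjective p fun x => ⟨i x, LinearMap.congr_fun hip x⟩

theorem projective_pi {ι : Type*} [Fintype ι] (Q : ι → Type u) [∀ k, AddCommGroup (Q k)]
    [∀ k, Module Λ (Q k)] (h : ∀ k, Module.Projective Λ (Q k)) : Module.Projective Λ (∀ k, Q k) := by
  classical
  exact Module.Projective.of_equiv (DFinsupp.linearEquivFunOnFintype (R := Λ) (M := Q))

theorem InAdd.projective [Module.Projective Λ V] (h : InAdd Λ V X) : Module.Projective Λ X := by
  obtain ⟨n, i, p, hip⟩ := h
  have : Module.Projective Λ (Fin n → V) := projective_pi (fun _ => V) fun _ => inferInstance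
  exact Module.Projective.of_split i p hip

theorem injective_of_retract [hV : Module.Injective Λ V] (i : X →ₗ[Λ] V) (p : V →ₗ[Λ] X)
    (h : p ∘ₗ i = LinearMap.id) : Module.Injective Λ X where
  out A B _ _ _ _ f hf g := by
    obtain ⟨k, hk⟩ := hV.out f hf (i ∘ₗ g)
    exact ⟨p ∘ₗ k, fun x => (congrArg p (hk x)).trans (LinearMap.congr_fun h (g x))⟩

theorem injective_pi {ι : Type} (Q : ι → Type u) [∀ k, AddCommGroup (Q k)]
    [∀ k, Module Λ (Q k)] (h : ∀ k, Module.Injective Λ (Q k)) : Module.Injective Λ (∀ k, Q k) where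
  out A B _ _ _ _ f hf g := by
    choose l hl using fun k => (h k).out f hf (LinearMap.proj k ∘ₗ g)
    exact ⟨LinearMap.pi l, fun x => funext fun k => hl k x⟩

theorem exists_ne_zero_of_nontrivial (h : Nontrivial (X →ₗ[Λ] Y)) : ∃ f : X →ₗ[Λ] Y, f ≠ 0 :=
  exists_ne 0

theorem nontrivial_of_ne_zero {f : X →ₗ[Λ] Y} (h : f ≠ 0) : Nontrivial (X →ₗ[Λ] Y) :=
  ⟨f, 0, h⟩

theorem nontrivial_congr_right (e : X ≃ₗ[Λ] Y) :
    Nontrivial (V →ₗ[Λ] X) ↔ Nontrivial (V →ₗ[Λ] Y) :=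
  Equiv.nontrivial_congr
    { toFun := fun f => e.toLinearMap ∘ₗ f
      invFun := fun f => e.symm.toLinearMap ∘ₗ f
      left_inv := fun f => by ext; simp
      right_inv := fun f => by ext; simp }

theorem nontrivial_congr_left (e : X ≃ₗ[Λ] Y) :
    Nontrivial (X →ₗ[Λ] V) ↔ Nontrivial (Y →ₗ[Λ] V) :=
  Equiv.nontrivial_congr
    { toFun := fun f => f ∘ₗ e.symm.toLinearMap
      invFun := fun f => f ∘ₗ e.toLinearMap
      left_inv := fun f => by ext; simp
      right_inv := fun f => by ext; simp }

theorem nontrivial_pi_hom {ι : Type} [Fintype ι] (Q : ι → Type u) [∀ k, AddCommGroup (Q k)]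
    [∀ k, Module Λ (Q k)] :
    Nontrivial ((∀ k, Q k) →ₗ[Λ] X) ↔ ∃ k, Nontrivial (Q k →ₗ[Λ] X) := by
  classical
  constructor
  · intro h
    obtain ⟨f, hf⟩ := exists_ne_zero_of_nontrivial h
    by_contra hcon
    push Not at hcon
    refine hf (LinearMap.pi_ext' fun k => ?_)
    have := hcon k
    exact Subsingleton.elim _ _
  · rintro ⟨k, h⟩
    obtain ⟨f, hf⟩ := exists_ne_zero_of_nontrivial h
    refine nontrivial_of_ne_zero (f := f ∘ₗ LinearMap.proj k) fun h0 => hf (LinearMap.ext fun x => ?_)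
    simpa using LinearMap.congr_fun h0 (Pi.single k x)

theorem nontrivial_hom_pi {ι : Type} (Q : ι → Type u) [∀ k, AddCommGroup (Q k)]
    [∀ k, Module Λ (Q k)] :
    Nontrivial (X →ₗ[Λ] (∀ k, Q k)) ↔ ∃ k, Nontrivial (X →ₗ[Λ] Q k) := by
  classical
  constructor
  · intro h
    obtain ⟨f, hf⟩ := exists_ne_zero_of_nontrivial h
    by_contra hcon
    push Not at hcon
    refine hf (LinearMap.ext fun x => funext fun k => ?_)
    have := hcon k
    exact LinearMap.congr_fun (Subsingleton.elim (LinearMap.proj k ∘ₗ f) 0) x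
  · rintro ⟨k, h⟩
    obtain ⟨f, hf⟩ := exists_ne_zero_of_nontrivial h
    refine nontrivial_of_ne_zero (f := LinearMap.single Λ Q k ∘ₗ f)
      fun h0 => hf (LinearMap.ext fun x => ?_)
    simpa using congrFun (LinearMap.congr_fun h0 x) k

/-- A module generated by `V` as a direct summand of `Vⁿ` has no more quotients than `V`. -/
theorem InAdd.nontrivial_hom (h : InAdd Λ V X) (hn : Nontrivial (X →ₗ[Λ] Y)) :
    Nontrivial (V →ₗ[Λ] Y) := by
  obtain ⟨n, i, p, hip⟩ := h
  obtain ⟨f, hf⟩ := exists_ne_zero_of_nontrivial hn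
  obtain ⟨-, h⟩ := (nontrivial_pi_hom fun _ : Fin n => V).1 <|
    nontrivial_of_ne_zero (f := f ∘ₗ p) fun h0 => hf (by
      rw [← LinearMap.comp_id f, ← hip, ← LinearMap.comp_assoc, h0, LinearMap.zero_comp])
  exact h

variable (X V) in
/-- A finitely generated projective module `X` is in `add V` for projective `V` if its simple
quotients are quotients of `V`: then `V` generates `X`, as the trace of `V` in `X` lies in no maximal
submodule. -/
theorem inAdd_of_top [Module.Finite Λ X] [Module.Projective Λ X] [Module.Projective Λ V]
    (h : ∀ (T : Type u) [AddCommGroup T] [Module Λ T], IsSimpleModule Λ T →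
      Nontrivial (X →ₗ[Λ] T) → Nontrivial (V →ₗ[Λ] T)) : InAdd Λ V X := by
  classical
  have htop : (⨆ f : V →ₗ[Λ] X, LinearMap.range f) = ⊤ := by
    by_contra hne
    obtain ⟨m, hm, hle⟩ := (eq_top_or_exists_le_coatom _).resolve_left hne
    have hs : IsSimpleModule Λ (X ⧸ m) := isSimpleModule_iff_isCoatom.2 hm
    have hne : m.mkQ ≠ 0 := fun h0 => hm.1 (by rw [← m.ker_mkQ, h0, LinearMap.ker_zero])
    obtain ⟨g, hg⟩ := exists_ne_zero_of_nontrivial (h _ hs (nontrivial_of_ne_zero hne))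
    obtain ⟨f, hf⟩ := Module.projective_lifting_property m.mkQ g m.mkQ_surjective
    refine hg (LinearMap.ext fun v => ?_)
    rw [← hf]
    exact (Submodule.Quotient.mk_eq_zero m).2
      (hle (Submodule.mem_iSup_of_mem f ⟨v, rfl⟩))
  have hc : IsCompactElement (⊤ : Submodule Λ X) :=
    (Submodule.fg_iff_compact _).1 Module.Finite.fg_top
  obtain ⟨s, hs⟩ := CompleteLattice.IsCompactElement.exists_finset_of_le_iSup _ hc
    (fun f : V →ₗ[Λ] X => LinearMap.range f) htop.ge
  let p : (s → V) →ₗ[Λ] X := LinearMap.lsum Λ _ ℕ fun f => f.1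
  have hp : Function.Surjective p := by
    rw [← LinearMap.range_eq_top, eq_top_iff]
    refine hs.trans (iSup₂_le fun f hf => ?_)
    rintro _ ⟨v, rfl⟩
    exact ⟨Pi.single ⟨f, hf⟩ v,
      LinearMap.lsum_piSingle Λ (fun _ : s => V) ℕ (fun f : s => f.1) ⟨f, hf⟩ v⟩
  obtain ⟨i, hi⟩ := Module.projective_lifting_property p LinearMap.id hp
  refine InAdd.of_sum (fun f : s => LinearMap.proj f ∘ₗ i) (fun f => f.1) ?_
  rw [← hi]
  ext x
  simp [p, LinearMap.lsum_apply]

variable (X V) in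
/-- An injective Artinian module `X` is in `add V` for injective `V` if its simple submodules embed
into `V`: then finitely many maps `X → V` already have zero common kernel. -/
theorem inAdd_of_socle [IsArtinian Λ X] [hX : Module.Injective Λ X] [hV : Module.Injective Λ V]
    (h : ∀ (T : Type u) [AddCommGroup T] [Module Λ T], IsSimpleModule Λ T →
      Nontrivial (T →ₗ[Λ] X) → Nontrivial (T →ₗ[Λ] V)) : InAdd Λ V X := by
  classical
  obtain ⟨_, ⟨s, rfl⟩, hmin⟩ := IsArtinian.set_has_minimal
    (Set.range fun s : Finset (X →ₗ[Λ] V) => s.inf fun f => LinearMap.ker f) ⟨_, ⟨∅, rfl⟩⟩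
  have hbot : (s.inf fun f => LinearMap.ker f) = ⊥ := by
    by_contra hne
    obtain ⟨m, hm, hle⟩ := (eq_bot_or_exists_atom_le _).resolve_left hne
    have hs : IsSimpleModule Λ m := isSimpleModule_iff_isAtom.2 hm
    have hne : m.subtype ≠ 0 := fun h0 => hm.1 (by
      rw [← m.range_subtype, h0, LinearMap.range_zero])
    obtain ⟨g, hg⟩ := exists_ne_zero_of_nontrivial (h m hs (nontrivial_of_ne_zero hne))
    obtain ⟨f, hf⟩ := hV.out m.subtype m.injective_subtype g
    refine hmin _ ⟨insert f s, rfl⟩ (lt_of_le_of_ne ?_ fun heq => hg ?_)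
    · simp only [Finset.inf_insert]
      exact inf_le_right
    · ext x
      rw [← hf]
      have hle' := hle.trans heq.ge
      simp only [Finset.inf_insert] at hle'
      exact (hle' x.2).1
  let i : X →ₗ[Λ] (s → V) := LinearMap.pi fun f => f.1
  have hi : Function.Injective i := by
    rw [← LinearMap.ker_eq_bot, eq_bot_iff, ← hbot]
    refine Finset.le_inf fun f hf x hx => ?_
    exact congrFun (LinearMap.mem_ker.1 hx) ⟨f, hf⟩
  obtain ⟨p, hp⟩ := hX.out i hi LinearMap.id
  refine InAdd.of_sum (fun f : s => f.1) (fun f => p ∘ₗ LinearMap.single Λ (fun _ => V) f) ?_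
  ext x
  have hx : i x = ∑ k, Pi.single k (i x k) := (Finset.univ_sum_single (i x)).symm
  have := congrArg p hx
  rw [hp, map_sum] at this
  simpa [i] using this.symm

end Add

/-! ### Indecomposable modules -/

section Indecomposable

variable {Λ : Type u} [Ring Λ]

/-- Fitting's lemma: the endomorphism ring of an indecomposable module of finite length is local. -/
theorem isLocalRing_end {X : Type u} [AddCommGroup X] [Module Λ X] [IsArtinian Λ X]
    [IsNoetherian Λ X] (h : IsIndecomposable Λ X) : IsLocalRing (Module.End Λ X) := by
  have := h.1
  refine IsLocalRing.of_isUnit_or_isUnit_one_sub_self fun f => ?_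
  obtain ⟨n, hn⟩ := Filter.eventually_atTop.1 f.eventually_isCompl_ker_pow_range_pow
  rcases h.2 _ _ (hn (n + 1) n.le_succ) with h0 | h0
  · refine Or.inl ((Module.End.isUnit_iff f).2 ?_)
    refine IsArtinian.bijective_of_injective_endomorphism f ?_
    rw [← LinearMap.ker_eq_bot, eq_bot_iff, ← h0, pow_succ]
    exact LinearMap.ker_le_ker_comp f (f ^ n)
  · exact Or.inr (IsNilpotent.isUnit_one_sub ⟨n + 1, LinearMap.range_eq_bot.1 h0⟩)

/-- The identity of `X` is a finite sum of idempotents `b k ∘ a k` whose images `Y k` are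
indecomposable. The idempotents are not required to be orthogonal. -/
def HasIndecomposableDecomposition (Λ : Type u) [Ring Λ] (X : Type u) [AddCommGroup X]
    [Module Λ X] : Prop :=
  ∃ (ι : Type) (_ : Fintype ι) (Y : ι → ModuleCat.{u} Λ) (a : ∀ k, X →ₗ[Λ] Y k)
    (b : ∀ k, Y k →ₗ[Λ] X), (∀ k, IsIndecomposable Λ (Y k)) ∧
      (∀ k, a k ∘ₗ b k = LinearMap.id) ∧ ∑ k, b k ∘ₗ a k = LinearMap.id

theorem HasIndecomposableDecomposition.of_prod {X X₁ X₂ : Type u} [AddCommGroup X] [Module Λ X]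
    [AddCommGroup X₁] [Module Λ X₁] [AddCommGroup X₂] [Module Λ X₂]
    (h₁ : HasIndecomposableDecomposition Λ X₁) (h₂ : HasIndecomposableDecomposition Λ X₂)
    (e : X ≃ₗ[Λ] X₁ × X₂) : HasIndecomposableDecomposition Λ X := by
  obtain ⟨ι, _, Y, a, b, hY, hab, hs⟩ := h₁
  obtain ⟨κ, _, Z, c, d, hZ, hcd, ht⟩ := h₂
  have hs' := fun x => LinearMap.congr_fun hs x
  have ht' := fun x => LinearMap.congr_fun ht x
  have hab' := fun k x => LinearMap.congr_fun (hab k) x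
  have hcd' := fun k x => LinearMap.congr_fun (hcd k) x
  simp only [LinearMap.sum_apply, LinearMap.comp_apply, LinearMap.id_apply] at hs' ht' hab' hcd'
  refine ⟨ι ⊕ κ, inferInstance, Sum.elim Y Z,
    fun k => match k with
      | .inl k => a k ∘ₗ LinearMap.fst Λ X₁ X₂ ∘ₗ e.toLinearMap
      | .inr k => c k ∘ₗ LinearMap.snd Λ X₁ X₂ ∘ₗ e.toLinearMap,
    fun k => match k with
      | .inl k => e.symm.toLinearMap ∘ₗ LinearMap.inl Λ X₁ X₂ ∘ₗ b k
      | .inr k => e.symm.toLinearMap ∘ₗ LinearMap.inr Λ X₁ X₂ ∘ₗ d k, ?_, ?_, ?_⟩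
  · rintro (k | k)
    exacts [hY k, hZ k]
  · rintro (k | k)
    · refine LinearMap.ext fun y => ?_
      change a k (e (e.symm (b k y, 0))).1 = y
      rw [e.apply_symm_apply]
      exact hab' k y
    · refine LinearMap.ext fun y => ?_
      change c k (e (e.symm (0, d k y))).2 = y
      rw [e.apply_symm_apply]
      exact hcd' k y
  · refine LinearMap.ext fun x => e.injective ?_
    rw [Fintype.sum_sum_type, LinearMap.add_apply, LinearMap.sum_apply, LinearMap.sum_apply,
      map_add, map_sum, map_sum]
    change ∑ k, e (e.symm (b k (a k (e x).1), 0)) + ∑ k, e (e.symm (0, d k (c k (e x).2))) = e x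
    simp only [e.apply_symm_apply]
    refine Prod.ext ?_ ?_
    · simp [Prod.fst_sum, hs']
    · simp [Prod.snd_sum, ht']

theorem hasIndecomposableDecomposition (X : Type u) [AddCommGroup X] [Module Λ X]
    [IsArtinian Λ X] : HasIndecomposableDecomposition Λ X := by
  have key : ∀ p : Submodule Λ X, HasIndecomposableDecomposition Λ p := by
    intro p
    induction p using WellFoundedLT.induction with
    | ind p ih =>
    rcases subsingleton_or_nontrivial p with hp | hp
    · exact ⟨PEmpty, inferInstance, nofun, nofun, nofun, nofun, nofun, Subsingleton.elim _ _⟩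
    by_cases hi : IsIndecomposable Λ p
    · exact ⟨Unit, inferInstance, fun _ => ModuleCat.of Λ p, fun _ => LinearMap.id,
        fun _ => LinearMap.id, fun _ => hi, fun _ => rfl, by simp⟩
    · obtain ⟨q, r, hqr, hq, hr⟩ : ∃ q r : Submodule Λ p, IsCompl q r ∧ q ≠ ⊥ ∧ r ≠ ⊥ := by
        by_contra hcon
        push Not at hcon
        exact hi ⟨hp, fun q r hqr => or_iff_not_imp_left.2 (hcon q r hqr)⟩
      have hlt : ∀ q : Submodule Λ p, q ≠ ⊤ → q.map p.subtype < p := fun q hq =>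
        lt_of_le_of_ne (Submodule.map_subtype_le p q) fun h => hq (by
          rw [← Submodule.map_injective_of_injective p.injective_subtype |>.eq_iff, h,
            Submodule.map_subtype_top])
      have eq' := fun q : Submodule Λ p =>
        Submodule.equivMapOfInjective p.subtype p.injective_subtype q
      exact (ih _ (hlt q fun h => hr (by simpa [h] using hqr.disjoint.eq_bot))).of_prod
        (ih _ (hlt r fun h => hq (by simpa [h] using hqr.disjoint.eq_bot)))
        ((Submodule.prodEquivOfIsCompl q r hqr).symm.trans ((eq' q).prodCongr (eq' r)))
  obtain ⟨ι, _, Y, a, b, hY, hab, hs⟩ := key ⊤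
  let e : (⊤ : Submodule Λ X) ≃ₗ[Λ] X := Submodule.topEquiv
  refine ⟨ι, inferInstance, Y, fun k => a k ∘ₗ e.symm.toLinearMap,
    fun k => e.toLinearMap ∘ₗ b k, hY, fun k => ?_, ?_⟩
  · ext y
    simpa using LinearMap.congr_fun (hab k) y
  · ext x
    have := congrArg e (LinearMap.congr_fun hs (e.symm x))
    simpa [LinearMap.sum_apply] using this

/-- Krull–Schmidt exchange: if the endomorphism ring of `X` is local and the identity of `X` factors
through a finite sum of indecomposable modules, then `X` is one of them. -/
theorem exists_linearEquiv_of_sum {X : Type u} [AddCommGroup X] [Module Λ X]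
    [IsLocalRing (Module.End Λ X)] {ι : Type*} [Fintype ι] (Y : ι → ModuleCat.{u} Λ)
    (hY : ∀ k, IsIndecomposable Λ (Y k)) (a : ∀ k, X →ₗ[Λ] Y k) (b : ∀ k, Y k →ₗ[Λ] X)
    (h : ∑ k, b k ∘ₗ a k = LinearMap.id) : ∃ k, Nonempty (X ≃ₗ[Λ] Y k) := by
  have hX : Nontrivial (Module.End Λ X) := inferInstance
  obtain ⟨k, -, hk⟩ : ∃ k ∈ Finset.univ, IsUnit (b k ∘ₗ a k : Module.End Λ X) := by
    by_contra hcon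
    push Not at hcon
    have : (∑ k, b k ∘ₗ a k : Module.End Λ X) ∈ nonunits (Module.End Λ X) := by
      refine Finset.sum_induction _ (· ∈ nonunits (Module.End Λ X)) (fun x y hx hy => ?_) ?_ hcon
      · exact IsLocalRing.nonunits_add hx hy
      · exact zero_mem_nonunits.2 zero_ne_one
    exact this (h ▸ isUnit_one)
  refine ⟨k, ?_⟩
  obtain ⟨u, hu⟩ := hk
  -- `r` is a retraction of `a k`
  let r : Y k →ₗ[Λ] X := (↑u⁻¹ : Module.End Λ X) ∘ₗ b k
  have hr : r ∘ₗ a k = LinearMap.id := by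
    change (↑u⁻¹ : Module.End Λ X) * (b k ∘ₗ a k : Module.End Λ X) = 1
    rw [← hu, Units.inv_mul]
  have hr' := fun x => LinearMap.congr_fun hr x
  have hc : IsCompl (LinearMap.range (a k)) (LinearMap.ker r) := by
    refine IsCompl.of_le ?_ fun y _ => ?_
    · rintro _ ⟨⟨x, rfl⟩, hx⟩
      have hx0 : x = 0 := (hr' x).symm.trans hx
      rw [hx0, map_zero]
      exact Submodule.zero_mem _
    · refine Submodule.mem_sup.2 ⟨a k (r y), ⟨_, rfl⟩, y - a k (r y), ?_, by abel⟩
      rw [LinearMap.mem_ker, map_sub]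
      exact sub_eq_zero.2 (hr' (r y)).symm
  have hinj : Function.Injective (a k) := fun x y hxy =>
    (hr' x).symm.trans ((congrArg r hxy).trans (hr' y))
  rcases (hY k).2 _ _ hc with h0 | h0
  · exfalso
    have ha : a k = 0 := LinearMap.range_eq_bot.1 h0
    refine zero_ne_one (α := Module.End Λ X) ?_
    change 0 = LinearMap.id
    rw [← hr, ha, LinearMap.comp_zero]
  · refine ⟨LinearEquiv.ofBijective (a k) ⟨hinj, LinearMap.range_eq_top.1 ?_⟩⟩
    simpa [h0] using hc.codisjoint.eq_top

end Indecomposable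

/-! ### Simple modules over an Artinian ring -/

section Simples

variable {Λ : Type u} [Ring Λ]

theorem linearEquiv_of_simple {S T : Type u} [AddCommGroup S] [Module Λ S] [AddCommGroup T]
    [Module Λ T] [IsSimpleModule Λ S] [IsSimpleModule Λ T] {f : S →ₗ[Λ] T} (hf : f ≠ 0) :
    Nonempty (S ≃ₗ[Λ] T) :=
  ⟨LinearEquiv.ofBijective f (LinearMap.bijective_of_ne_zero hf)⟩

/-- The simple quotients of a module of finite length fall into finitely many isomorphism classes,
as they are all composition factors. -/
theorem exists_finite_simple_quotients (M : Type u) [AddCommGroup M] [Module Λ M]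
    (h : IsFiniteLength Λ M) :
    ∃ s : Set (ModuleCat.{u} Λ), s.Finite ∧ ∀ (T : Type u) [AddCommGroup T] [Module Λ T],
      IsSimpleModule Λ T → Nontrivial (M →ₗ[Λ] T) → ∃ S ∈ s, Nonempty (T ≃ₗ[Λ] S) := by
  induction h with
  | of_subsingleton =>
    refine ⟨∅, Set.finite_empty, fun T _ _ _ hn => ?_⟩
    exact (not_subsingleton_iff_nontrivial.2 hn ⟨fun f g =>
      LinearMap.ext fun x => by rw [Subsingleton.elim x 0, map_zero, map_zero]⟩).elim
  | @of_simple_quotient M _ _ N hN _ ih =>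
    obtain ⟨s, hs, h⟩ := ih
    refine ⟨insert (ModuleCat.of Λ (M ⧸ N)) s, hs.insert _, fun T _ _ hT hn => ?_⟩
    obtain ⟨f, hf⟩ := exists_ne_zero_of_nontrivial hn
    by_cases h0 : f ∘ₗ N.subtype = 0
    · have hle : N ≤ LinearMap.ker f := fun x hx => LinearMap.congr_fun h0 ⟨x, hx⟩
      have hne : N.liftQ f hle ≠ 0 := fun h1 => hf (by
        rw [← N.liftQ_mkQ f hle, h1, LinearMap.zero_comp])
      obtain ⟨e⟩ := linearEquiv_of_simple hne
      exact ⟨_, Set.mem_insert _ _, ⟨e.symm⟩⟩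
    · obtain ⟨S, hS, e⟩ := h T hT (nontrivial_of_ne_zero h0)
      exact ⟨S, Set.mem_insert_of_mem _ hS, e⟩

/-- A left Artinian ring has, up to isomorphism, a finite irredundant list of simple modules. -/
theorem exists_simple_representatives (Λ : Type u) [Ring Λ] [IsArtinianRing Λ] :
    ∃ (n : ℕ) (S : Fin n → ModuleCat.{u} Λ),
      (∀ s, IsSimpleModule Λ (S s)) ∧
      (∀ (T : Type u) [AddCommGroup T] [Module Λ T], IsSimpleModule Λ T →
        ∃ s, Nonempty (T ≃ₗ[Λ] S s)) ∧
      ∀ s t, Nonempty (S s ≃ₗ[Λ] S t) → s = t := by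
  obtain ⟨s, hs, h⟩ := exists_finite_simple_quotients (Λ := Λ) Λ
    (isFiniteLength_iff_isNoetherian_isArtinian.2
      ⟨inferInstanceAs (IsNoetherianRing Λ), inferInstanceAs (IsArtinianRing Λ)⟩)
  let t : Set (ModuleCat.{u} Λ) := {S ∈ s | IsSimpleModule Λ S}
  have : Finite t := (hs.subset (Set.sep_subset _ _)).to_subtype
  let r : Setoid t :=
    { r := fun S T => Nonempty (S.1 ≃ₗ[Λ] T.1)
      iseqv := ⟨fun _ => ⟨LinearEquiv.refl Λ _⟩, fun ⟨e⟩ => ⟨e.symm⟩,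
        fun ⟨e⟩ ⟨f⟩ => ⟨e.trans f⟩⟩ }
  let e₀ := Finite.equivFin (Quotient r)
  refine ⟨_, fun k => (e₀.symm k).out.1, fun k => (e₀.symm k).out.2.2,
    fun T _ _ hT => ?_, fun p q hpq => e₀.symm.injective ?_⟩
  · obtain ⟨x, hx⟩ := @exists_ne T (IsSimpleModule.nontrivial Λ T) 0
    have hn : LinearMap.toSpanSingleton Λ T x ≠ 0 := fun h0 => hx (by
      simpa using LinearMap.congr_fun h0 1)
    obtain ⟨S, hS, ⟨e⟩⟩ := h T hT (nontrivial_of_ne_zero hn)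
    have hS' : IsSimpleModule Λ S := IsSimpleModule.congr e.symm
    obtain ⟨e'⟩ : Nonempty ((Quotient.mk r ⟨S, hS, hS'⟩).out.1 ≃ₗ[Λ] S) :=
      Quotient.mk_out (s := r) ⟨S, hS, hS'⟩
    refine ⟨e₀ (Quotient.mk r ⟨S, hS, hS'⟩), ?_⟩
    beta_reduce
    rw [e₀.symm_apply_apply]
    exact ⟨e.trans e'.symm⟩
  · rw [← (e₀.symm p).out_eq, ← (e₀.symm q).out_eq]
    exact Quotient.sound hpq

end Simples

/-! ### Tops and socles of projective-injective modules -/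

section ProjectiveInjective

variable {Λ : Type u} [Ring Λ] [IsArtinianRing Λ]

/-- Two simple submodules of an indecomposable injective module of finite length are equal:
a nontrivial idempotent of their sum would extend to an endomorphism `e` with neither `e` nor `1 - e`
injective. -/
theorem range_eq_of_simple {J : Type u} [AddCommGroup J] [Module Λ J] [Module.Finite Λ J]
    [hJ : Module.Injective Λ J] (hi : IsIndecomposable Λ J) {S S' : Submodule Λ J}
    (hS : IsAtom S) (hS' : IsAtom S') : S = S' := by
  have := isLocalRing_end hi
  by_contra hne
  have hd : Disjoint S S' := hS.disjoint_of_ne hS' hne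
  have hinj : Function.Injective (S.subtype.coprod S'.subtype) := by
    rw [← LinearMap.ker_eq_bot, LinearMap.ker_coprod_of_disjoint_range]
    · simp
    · simpa using hd
  obtain ⟨e, he⟩ := hJ.out _ hinj (S.subtype ∘ₗ LinearMap.fst Λ S S')
  have he1 : ∀ x ∈ S, e x = x := fun x hx => by simpa using he (⟨x, hx⟩, 0)
  have he2 : ∀ x ∈ S', e x = 0 := fun x hx => by simpa using he (0, ⟨x, hx⟩)
  obtain ⟨x, hx, hx0⟩ := S.ne_bot_iff.1 hS.1
  obtain ⟨y, hy, hy0⟩ := S'.ne_bot_iff.1 hS'.1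
  rcases IsLocalRing.isUnit_or_isUnit_of_add_one
      (add_sub_cancel (e : Module.End Λ J) 1) with h | h
  · refine hy0 (((Module.End.isUnit_iff e).1 h).1 ?_)
    rw [he2 y hy, map_zero]
  · refine hx0 (((Module.End.isUnit_iff _).1 h).1 ?_)
    rw [map_zero, LinearMap.sub_apply, Module.End.one_apply, he1 x hx, sub_self]

/-- Indecomposable projective modules `J` and `J'` with a common simple quotient are isomorphic, so
their simple submodules `S` and `S'` are isomorphic if `J'` is injective. -/
theorem linearEquiv_of_common_top {J J' S S' T : Type u} [AddCommGroup J] [Module Λ J]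
    [Module.Finite Λ J] [Module.Projective Λ J] (hi : IsIndecomposable Λ J)
    [AddCommGroup J'] [Module Λ J'] [Module.Finite Λ J'] [Module.Projective Λ J']
    [Module.Injective Λ J'] (hi' : IsIndecomposable Λ J')
    [AddCommGroup S] [Module Λ S] [IsSimpleModule Λ S] [AddCommGroup S'] [Module Λ S']
    [IsSimpleModule Λ S'] [AddCommGroup T] [Module Λ T] [IsSimpleModule Λ T]
    {i : S →ₗ[Λ] J} (h_i : i ≠ 0) {i' : S' →ₗ[Λ] J'} (h_i' : i' ≠ 0)
    {q : J →ₗ[Λ] T} (hq : q ≠ 0) {q' : J' →ₗ[Λ] T} (hq' : q' ≠ 0) :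
    Nonempty (S ≃ₗ[Λ] S') := by
  have := isLocalRing_end hi
  obtain ⟨f, hf⟩ := Module.projective_lifting_property q' q (LinearMap.surjective_of_ne_zero hq')
  obtain ⟨g, hg⟩ := Module.projective_lifting_property q q' (LinearMap.surjective_of_ne_zero hq)
  -- `g ∘ f` is the identity on the quotient `T`, so `1 - g ∘ f` is not a unit
  have hqgf : q ∘ₗ g ∘ₗ f = q := by rw [← LinearMap.comp_assoc, hg, hf]
  have hu : IsUnit (g ∘ₗ f : Module.End Λ J) := by
    refine (IsLocalRing.isUnit_or_isUnit_of_add_one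
      (add_sub_cancel (g ∘ₗ f : Module.End Λ J) 1)).resolve_right fun h => hq ?_
    obtain ⟨-, hsurj⟩ := (Module.End.isUnit_iff _).1 h
    ext x
    obtain ⟨y, rfl⟩ := hsurj x
    rw [LinearMap.sub_apply, map_sub]
    exact sub_eq_zero.2 (LinearMap.congr_fun hqgf y).symm
  have hfi : Function.Injective f :=
    Function.Injective.of_comp (f := g) ((Module.End.isUnit_iff _).1 hu).1
  have hinj : Function.Injective (f ∘ₗ i) := hfi.comp (LinearMap.injective_of_ne_zero h_i)
  have hinj' : Function.Injective i' := LinearMap.injective_of_ne_zero h_i'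
  let e := LinearEquiv.ofInjective (f ∘ₗ i) hinj
  let e' := LinearEquiv.ofInjective i' hinj'
  have ha : IsAtom (LinearMap.range (f ∘ₗ i)) :=
    isSimpleModule_iff_isAtom.1 (IsSimpleModule.congr e.symm)
  have ha' : IsAtom (LinearMap.range i') :=
    isSimpleModule_iff_isAtom.1 (IsSimpleModule.congr e'.symm)
  exact ⟨e.trans ((LinearEquiv.ofEq _ _ (range_eq_of_simple hi' ha ha')).trans e'.symm)⟩

/-- A finitely generated projective-injective module has at least as many simple quotients as simple
submodules, up to isomorphism: send the socle of an indecomposable summand to its top. -/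
theorem exists_injective_socle_to_top {σ : Type*} (S : σ → ModuleCat.{u} Λ)
    (hS : ∀ s, IsSimpleModule Λ (S s))
    (hall : ∀ (T : Type u) [AddCommGroup T] [Module Λ T], IsSimpleModule Λ T →
        ∃ s, Nonempty (T ≃ₗ[Λ] S s))
    (hiso : ∀ s t, Nonempty (S s ≃ₗ[Λ] S t) → s = t)
    (I : Type u) [AddCommGroup I] [Module Λ I] [Module.Finite Λ I] [Module.Projective Λ I]
    [Module.Injective Λ I] :
    ∃ φ : {s // Nontrivial (S s →ₗ[Λ] I)} → {s // Nontrivial (I →ₗ[Λ] S s)},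
      Function.Injective φ := by
  obtain ⟨ι, _, Y, a, b, hY, hab, hs⟩ := hasIndecomposableDecomposition (Λ := Λ) I
  have hfin : ∀ k, Module.Finite Λ (Y k) := fun k =>
    (InAdd.of_retract (b k) (a k) (hab k)).finite
  have hproj : ∀ k, Module.Projective Λ (Y k) := fun k =>
    (InAdd.of_retract (b k) (a k) (hab k)).projective
  have hinj : ∀ k, Module.Injective Λ (Y k) := fun k =>
    injective_of_retract (b k) (a k) (hab k)
  have key : ∀ s : {s // Nontrivial (S s →ₗ[Λ] I)}, ∃ (k : ι) (t : σ) (i : S s.1 →ₗ[Λ] Y k)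
      (q : Y k →ₗ[Λ] S t), i ≠ 0 ∧ q ≠ 0 := by
    rintro ⟨s, hs'⟩
    obtain ⟨f, hf⟩ := exists_ne_zero_of_nontrivial hs'
    obtain ⟨k, hk⟩ : ∃ k, a k ∘ₗ f ≠ 0 := by
      by_contra hcon
      push Not at hcon
      refine hf (LinearMap.ext fun x => ?_)
      rw [← LinearMap.id_apply (R := Λ) (f x), ← hs, LinearMap.sum_apply]
      refine Finset.sum_eq_zero fun k _ => ?_
      exact (congrArg (b k) (LinearMap.congr_fun (hcon k) x)).trans (map_zero _)
    have := (hY k).1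
    obtain ⟨m, hm, -⟩ := (eq_top_or_exists_le_coatom (⊥ : Submodule Λ (Y k))).resolve_left
      bot_ne_top
    have hsm : IsSimpleModule Λ (Y k ⧸ m) := isSimpleModule_iff_isCoatom.2 hm
    obtain ⟨t, ⟨e⟩⟩ := hall _ hsm
    refine ⟨k, t, a k ∘ₗ f, e.toLinearMap ∘ₗ m.mkQ, hk, fun h0 => hm.1 ?_⟩
    rw [← m.ker_mkQ, ← LinearEquiv.ker_comp e, h0, LinearMap.ker_zero]
  choose k t i q hi hq using key
  refine ⟨fun s => ⟨t s, nontrivial_of_ne_zero (f := q s ∘ₗ a (k s)) fun h0 => hq s ?_⟩,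
    fun s s' h => Subtype.ext (hiso _ _ ?_)⟩
  · rw [← LinearMap.comp_id (q s), ← hab, ← LinearMap.comp_assoc, h0, LinearMap.zero_comp]
  · have ht : t s = t s' := congrArg Subtype.val h
    have := hS
    generalize q s = qs, hq s = hqs at *
    revert qs
    rw [ht]
    intro qs hqs
    exact linearEquiv_of_common_top (hY _) (hY _) (hi s) (hi s') hqs (hq s')

end ProjectiveInjective

/-! ### The dualizing module -/

section Envelope

variable {R : Type u} [CommRing R] [IsArtinianRing R]

theorem isInjectiveEnvelope_dualizingModule (R : Type u) [CommRing R] :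
    IsInjectiveEnvelope R (R ⧸ Ring.jacobson R) (dualizingModule R) :=
  (exists_injectiveEnvelope R (R ⧸ Ring.jacobson R)).choose_spec

/-- An essential extension of a finitely generated module over a commutative Artinian ring is
finitely generated: the submodule killed by the radical `J` is semisimple, so it lies in the given
module, and multiplication by generators of `J ^ k` embeds the quotient of the submodules killed by
`J ^ (k + 1)` and by `J ^ k` into a finite power of it. -/
theorem finite_of_essential {S E : Type u} [AddCommGroup S] [Module R S] [Module.Finite R S]
    [AddCommGroup E] [Module R E] (ι : S →ₗ[R] E)
    (hess : ∀ p : Submodule R E, p ⊓ LinearMap.range ι = ⊥ → p = ⊥) : Module.Finite R E := by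
  set J : Ideal R := Ring.jacobson R with hJ
  let T : ℕ → Submodule R E := fun k => Submodule.torsionBySet R E (J ^ k : Ideal R)
  have hmem : ∀ k x, x ∈ T k ↔ ∀ r ∈ J ^ k, r • x = 0 := fun k x => by
    simp [T, Submodule.mem_torsionBySet_iff]
  -- `T 1` is semisimple, so essentiality leaves no complement to its intersection with `ι S`
  have hT1 : T 1 ≤ LinearMap.range ι := by
    have htor : Module.IsTorsionBySet R (T 1) (J : Set R) := fun x r =>
      Subtype.ext ((hmem 1 x.1).1 x.2 r.1 ((pow_one J).symm ▸ r.2))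
    have : IsSemisimpleModule R (T 1) := by
      let _ := htor.module
      have : IsSemisimpleRing (R ⧸ J) := IsSemiprimaryRing.isSemisimpleRing
      exact htor.isSemisimpleModule_iff.1 inferInstance
    obtain ⟨q, hq⟩ := exists_isCompl ((LinearMap.range ι).comap (T 1).subtype)
    have h0 : q.map (T 1).subtype = ⊥ := hess _ <| (Submodule.eq_bot_iff _).2 <| by
      rintro _ ⟨⟨x, hx, rfl⟩, hx'⟩
      have : x = 0 := by
        have : x ∈ (⊥ : Submodule R (T 1)) := hq.disjoint.eq_bot ▸ ⟨hx', hx⟩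
        simpa using this
      simp [this]
    have hq0 : q = ⊥ := by
      exact Submodule.map_injective_of_injective (T 1).injective_subtype
        (h0.trans (Submodule.map_bot _).symm)
    have := hq.codisjoint.eq_top
    rw [hq0, sup_bot_eq] at this
    intro x hx
    have hx' : (⟨x, hx⟩ : T 1) ∈ (LinearMap.range ι).comap (T 1).subtype := this ▸ trivial
    exact hx'
  have hN1 : IsNoetherian R (T 1) := isNoetherian_of_le hT1
  have key : ∀ k, IsNoetherian R (T k) := by
    intro k
    induction k with
    | zero =>
      have : T 0 = ⊥ := (Submodule.eq_bot_iff _).2 fun x hx => by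
        simpa using (hmem 0 x).1 hx 1 (by simp)
      rw [this]
      infer_instance
    | succ k ih =>
      obtain ⟨s, hs⟩ : (J ^ k).FG := IsNoetherian.noetherian _
      have hle : T k ≤ T (k + 1) := fun x hx =>
        (hmem _ _).2 fun r hr => (hmem _ _).1 hx r (Ideal.pow_le_pow_right k.le_succ hr)
      have hmul : ∀ r : s, ∀ x ∈ T (k + 1), r.1 • x ∈ T 1 := fun r x hx =>
        (hmem _ _).2 fun j hj => by
          rw [smul_smul]
          refine (hmem _ _).1 hx _ ?_
          rw [pow_succ']
          refine Ideal.mul_mem_mul (by simpa using hj) ?_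
          rw [← hs]
          exact Submodule.subset_span r.2
      let φ : T (k + 1) →ₗ[R] (s → T 1) := LinearMap.pi fun r =>
        (LinearMap.lsmul R E r.1).restrict (hmul r)
      refine isNoetherian_of_range_eq_ker (Submodule.inclusion hle) φ ?_
      ext x
      simp only [Submodule.range_inclusion, Submodule.mem_comap, Submodule.subtype_apply,
        LinearMap.mem_ker]
      constructor
      · intro hx
        refine funext fun r => Subtype.ext ?_
        exact (hmem _ _).1 hx r.1 (hs ▸ Submodule.subset_span r.2)
      · intro hx
        refine (hmem _ _).2 fun r hr => ?_
        rw [← hs] at hr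
        induction hr using Submodule.span_induction with
        | mem r hr => exact congrArg Subtype.val (congrFun hx ⟨r, hr⟩)
        | zero => exact zero_smul _ _
        | add a b _ _ ha hb => rw [add_smul, ha, hb, add_zero]
        | smul a b _ hb => rw [smul_assoc, hb, smul_zero]
  obtain ⟨n, hn⟩ : IsNilpotent J := IsSemiprimaryRing.isNilpotent
  have htop : T n = ⊤ := eq_top_iff.2 fun x _ => (hmem _ _).2 fun r hr => by
    rw [hn] at hr
    rw [show r = 0 from hr, zero_smul]
  have := key n
  rw [htop] at this
  have : IsNoetherian R E := isNoetherian_of_linearEquiv Submodule.topEquiv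
  infer_instance

theorem finite_dualizingModule : Module.Finite R (dualizingModule R) := by
  obtain ⟨-, ι, -, hess⟩ := isInjectiveEnvelope_dualizingModule R
  exact finite_of_essential ι hess

/-- The dualizing module is a cogenerator, since `R / rad R` contains every simple module. -/
theorem nontrivial_dual (U : Type u) [AddCommGroup U] [Module R U] [Nontrivial U] :
    Nontrivial (U →ₗ[R] dualizingModule R) := by
  obtain ⟨hE, ι, hι, -⟩ := isInjectiveEnvelope_dualizingModule R
  obtain ⟨u, hu⟩ := exists_ne (0 : U)
  let p : Submodule R U := Submodule.span R {u}
  let u' : p := ⟨u, Submodule.mem_span_singleton_self u⟩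
  have : Nontrivial p := ⟨u', 0, fun h => hu (congrArg Subtype.val h)⟩
  obtain ⟨m, hm, -⟩ := (eq_top_or_exists_le_coatom (⊥ : Submodule R p)).resolve_left bot_ne_top
  have hs : IsSimpleModule R (p ⧸ m) := isSimpleModule_iff_isCoatom.2 hm
  obtain ⟨f, hf⟩ : ∃ f : p ⧸ m →ₗ[R] R ⧸ Ring.jacobson R, f ≠ 0 := by
    have hss : IsSemisimpleModule R (R ⧸ Ring.jacobson R) := by
      let φ : (R ⧸ Ring.jacobson R) →ₛₗ[Ideal.Quotient.mk (Ring.jacobson R)] R ⧸ Ring.jacobson R :=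
        { toFun := id, map_add' := fun _ _ => rfl, map_smul' := fun r x => Algebra.smul_def r x }
      exact (φ.isSemisimpleModule_iff_of_bijective Function.bijective_id).2 inferInstance
    have := hs.nontrivial
    obtain ⟨t, ht⟩ := exists_ne (0 : p ⧸ m)
    have hle : Ring.jacobson R ≤ LinearMap.ker (LinearMap.toSpanSingleton R (p ⧸ m) t) :=
      fun r hr =>
        Module.mem_annihilator.1 (IsSemisimpleModule.jacobson_le_annihilator R _ hr) t
    let g := (Ring.jacobson R).liftQ _ hle
    have hg : Function.Surjective g := LinearMap.surjective_of_ne_zero fun h0 => ht <| by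
      have h1 : g (Submodule.Quotient.mk 1) = t := by
        rw [Submodule.liftQ_apply, LinearMap.toSpanSingleton_apply, one_smul]
      rw [← h1, h0, LinearMap.zero_apply]
    obtain ⟨N, ⟨e⟩⟩ :=
      IsSemisimpleModule.exists_submodule_linearEquiv_quotient (LinearMap.ker g)
    let e' := (g.quotKerEquivOfSurjective hg).symm.trans e.symm
    refine ⟨N.subtype ∘ₗ e'.toLinearMap, fun h0 => ht (e'.injective (Subtype.ext ?_))⟩
    simpa using LinearMap.congr_fun h0 t
  obtain ⟨k, hk⟩ := hE.out p.subtype p.injective_subtype (ι ∘ₗ f ∘ₗ m.mkQ)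
  refine ⟨k, 0, fun h0 => hf ?_⟩
  ext x
  refine hι ?_
  have := hk x
  rw [h0] at this
  simpa using this.symm

end Envelope

/-! ### Homomorphisms into `ν P` -/

section Nakayama

variable {R : Type u} [CommRing R] {Λ : Type u} [Ring Λ] [Algebra R Λ]

theorem finite_linearMap [IsNoetherianRing R] {X Y : Type u} [AddCommGroup X] [Module Λ X]
    [Module.Finite Λ X] [AddCommGroup Y] [Module Λ Y] [Module R Y] [IsScalarTower R Λ Y]
    [Module.Finite R Y] : Module.Finite R (X →ₗ[Λ] Y) := by
  obtain ⟨n, v, hv⟩ := Module.Finite.exists_fin (R := Λ) (M := X)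
  let φ : (X →ₗ[Λ] Y) →ₗ[R] (Fin n → Y) :=
    { toFun := fun f k => f (v k), map_add' := fun _ _ => rfl, map_smul' := fun _ _ => rfl }
  refine Module.Finite.of_injective φ fun f g hfg => ?_
  exact LinearMap.ext_on_range hv fun k => congrFun hfg k

/-- A finitely generated projective module has a dual basis. -/
theorem exists_dual_basis (P : Type u) [AddCommGroup P] [Module Λ P] [Module.Finite Λ P]
    [Module.Projective Λ P] : ∃ (n : ℕ) (v : Fin n → P) (c : Fin n → P →ₗ[Λ] Λ),
      ∀ p, ∑ k, c k p • v k = p := by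
  obtain ⟨n, f, hf⟩ := Module.Finite.exists_fin' Λ P
  obtain ⟨g, hg⟩ := Module.projective_lifting_property f LinearMap.id hf
  refine ⟨n, fun k => f (Pi.single k 1), fun k => LinearMap.proj k ∘ₗ g, fun p => ?_⟩
  have hx : g p = ∑ k, g p k • (Pi.single k 1 : Fin n → Λ) := by
    simp_rw [← Pi.single_smul, smul_eq_mul, mul_one]
    exact (Finset.univ_sum_single (g p)).symm
  have := congrArg f hx
  rw [map_sum, ← LinearMap.comp_apply, hg] at this
  simpa using this.symm

variable {P : Type u} [AddCommGroup P] [Module Λ P] {X : Type u} [AddCommGroup X] [Module Λ X]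
  [Module R X] [IsScalarTower R Λ X]

/-- The natural map `D Hom_Λ(P, X) → Hom_Λ(X, ν P)`, sending `ψ` to `x ↦ (g ↦ ψ (g(-) x))`. -/
noncomputable def nakayamaOfDual (ψ : (P →ₗ[Λ] X) →ₗ[R] dualizingModule R) :
    X →ₗ[Λ] NakayamaCarrier R (Λ := Λ) P where
  toFun x := show (P →ₗ[Λ] Λ) →ₗ[R] dualizingModule R from
    { toFun := fun g => ψ (g.smulRight x)
      map_add' := fun g h => by
        rw [← map_add]
        exact congrArg ψ (LinearMap.ext fun p => add_smul (g p) (h p) x)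
      map_smul' := fun r g => by
        rw [RingHom.id_apply, ← map_smul]
        exact congrArg ψ (LinearMap.ext fun p => smul_assoc r (g p) x) }
  map_add' x y := LinearMap.ext fun g => by
    refine Eq.trans (congrArg ψ ?_) (map_add ψ _ _)
    exact LinearMap.ext fun p => smul_add (g p) x y
  map_smul' a x := LinearMap.ext fun g =>
    congrArg ψ (LinearMap.ext fun p => (mul_smul (g p) a x).symm)

theorem nakayamaOfDual_apply (ψ : (P →ₗ[Λ] X) →ₗ[R] dualizingModule R) (x : X)
    (g : P →ₗ[Λ] Λ) : (show (P →ₗ[Λ] Λ) →ₗ[R] dualizingModule R from nakayamaOfDual ψ x) g =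
      ψ (g.smulRight x) := rfl

variable [Module.Finite Λ P]

theorem finite_nakayama [IsArtinianRing R] [Module.Finite R Λ] :
    Module.Finite Λ (NakayamaCarrier R (Λ := Λ) P) := by
  have h1 : Module.Finite R (P →ₗ[Λ] Λ) := finite_linearMap
  have h2 : Module.Finite R (dualizingModule R) := finite_dualizingModule
  let _ : Module R (NakayamaCarrier R (Λ := Λ) P) :=
    (LinearMap.module : Module R ((P →ₗ[Λ] Λ) →ₗ[R] dualizingModule R))
  have h3 : Module.Finite R (NakayamaCarrier R (Λ := Λ) P) :=
    finite_linearMap (R := R) (Λ := R) (X := P →ₗ[Λ] Λ) (Y := dualizingModule R)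
  have : IsScalarTower R Λ (NakayamaCarrier R (Λ := Λ) P) := by
    refine IsScalarTower.of_algebraMap_smul fun r φ => LinearMap.ext fun g => ?_
    let φ' : (P →ₗ[Λ] Λ) →ₗ[R] dualizingModule R := φ
    change φ' (op (algebraMap R Λ r) • g) = r • φ' g
    rw [← map_smul]
    congr 1
    ext p
    simpa [Algebra.smul_def] using (Algebra.commutes r (g p)).symm
  exact Module.Finite.of_restrictScalars_finite R Λ _

variable [Module.Projective Λ P]

theorem nakayamaOfDual_injective :
    Function.Injective (nakayamaOfDual (R := R) (Λ := Λ) (P := P) (X := X)) := by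
  obtain ⟨n, v, c, hvc⟩ := exists_dual_basis (Λ := Λ) P
  intro ψ ψ' h
  ext f
  have hf : f = ∑ k, (c k).smulRight (f (v k)) := by
    ext p
    conv_lhs => rw [← hvc p]
    simp [map_sum, LinearMap.sum_apply]
  rw [hf, map_sum, map_sum]
  refine Finset.sum_congr rfl fun k _ => ?_
  rw [← nakayamaOfDual_apply, ← nakayamaOfDual_apply, h]

/-- A preimage of `φ` is given by a dual basis `v`, `c` of `P`: it is
`f ↦ ∑ φ (f (v k)) (c k)`. -/
theorem nakayamaOfDual_surjective :
    Function.Surjective (nakayamaOfDual (R := R) (Λ := Λ) (P := P) (X := X)) := by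
  obtain ⟨n, v, c, hvc⟩ := exists_dual_basis (Λ := Λ) P
  intro φ
  let φ' : X → (P →ₗ[Λ] Λ) →ₗ[R] dualizingModule R := fun x => φ x
  have hadd : ∀ x y, φ' (x + y) = φ' x + φ' y := fun x y => map_add φ x y
  have hsmul : ∀ (a : Λ) x g, φ' (a • x) g = φ' x (op a • g) := fun a x g =>
    LinearMap.congr_fun (map_smul φ a x) g
  refine ⟨{ toFun := fun f => ∑ k, φ' (f (v k)) (c k), map_add' := ?_, map_smul' := ?_ }, ?_⟩
  · intro f f'
    rw [← Finset.sum_add_distrib]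
    exact Finset.sum_congr rfl fun k _ => by rw [LinearMap.add_apply, hadd, LinearMap.add_apply]
  · intro r f
    rw [RingHom.id_apply, Finset.smul_sum]
    refine Finset.sum_congr rfl fun k _ => ?_
    rw [LinearMap.smul_apply, ← algebraMap_smul Λ r (f (v k)), hsmul, ← map_smul]
    congr 1
    ext p
    simpa [Algebra.smul_def] using (Algebra.commutes r (c k p)).symm
  · refine LinearMap.ext fun x => LinearMap.ext fun g => ?_
    have hg : g = ∑ k, op (g (v k)) • c k := by
      ext p
      conv_lhs => rw [← hvc p]
      simp [map_sum, LinearMap.sum_apply]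
    change ∑ k, φ' (g (v k) • x) (c k) = φ' x g
    conv_rhs => rw [hg, map_sum]
    exact Finset.sum_congr rfl fun k _ => hsmul _ _ _

theorem nontrivial_hom_nakayama [IsArtinianRing R] :
    Nontrivial (X →ₗ[Λ] NakayamaCarrier R (Λ := Λ) P) ↔ Nontrivial (P →ₗ[Λ] X) := by
  let e := Equiv.ofBijective (nakayamaOfDual (R := R) (Λ := Λ) (P := P) (X := X))
    ⟨nakayamaOfDual_injective, nakayamaOfDual_surjective⟩
  rw [← e.nontrivial_congr]
  refine ⟨fun ⟨ψ, ψ', h⟩ => ?_, fun h => nontrivial_dual _⟩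
  by_contra hn
  rw [not_nontrivial_iff_subsingleton] at hn
  exact h (LinearMap.ext fun f => by rw [Subsingleton.elim f 0, map_zero, map_zero])

/-- By `Hom(-, ν P) ≅ D Hom(P, -)` with exact `Hom(P, -)` and `D`, the module `ν P` is injective. -/
theorem injective_nakayama : Module.Injective Λ (NakayamaCarrier R (Λ := Λ) P) where
  out X Y _ _ _ _ i hi φ := by
    let _ := Module.compHom X (algebraMap R Λ)
    let _ := Module.compHom Y (algebraMap R Λ)
    have : IsScalarTower R Λ X := IsScalarTower.of_algebraMap_smul fun _ _ => rfl
    have : IsScalarTower R Λ Y := IsScalarTower.of_algebraMap_smul fun _ _ => rfl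
    obtain ⟨ψ, rfl⟩ := nakayamaOfDual_surjective φ
    let i' : (P →ₗ[Λ] X) →ₗ[R] (P →ₗ[Λ] Y) :=
      { toFun := fun f => i ∘ₗ f
        map_add' := fun f g => LinearMap.comp_add f g i
        map_smul' := fun r f => LinearMap.ext fun p => by
          change i (r • f p) = r • i (f p)
          rw [← algebraMap_smul Λ r (f p), map_smul, algebraMap_smul] }
    have hi' : Function.Injective i' := fun f g hfg =>
      LinearMap.ext fun p => hi (LinearMap.congr_fun hfg p)
    obtain ⟨χ, hχ⟩ := (isInjectiveEnvelope_dualizingModule R).1.out i' hi' ψ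
    refine ⟨nakayamaOfDual χ, fun x => LinearMap.ext fun g => ?_⟩
    change χ (g.smulRight (i x)) = ψ (g.smulRight x)
    rw [← hχ]
    refine congrArg χ (LinearMap.ext fun p => ?_)
    simp [i']

end Nakayama

/-- The socle of `ν P` is the top of `P`: take simple `X`. -/
theorem nontrivial_nakayama_iff {R : Type u} [CommRing R] [IsArtinianRing R] {Λ : Type u} [Ring Λ]
    [Algebra R Λ] {P : Type u} [AddCommGroup P] [Module Λ P] [Module.Finite Λ P]
    [Module.Projective Λ P] (X : Type u) [AddCommGroup X] [Module Λ X] :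
    Nontrivial (X →ₗ[Λ] NakayamaCarrier R (Λ := Λ) P) ↔ Nontrivial (P →ₗ[Λ] X) := by
  let _ := Module.compHom X (algebraMap R Λ)
  have : IsScalarTower R Λ X := IsScalarTower.of_algebraMap_smul fun _ _ => rfl
  exact nontrivial_hom_nakayama

/-! ### Balanced modules and `ν`-stable projective modules -/

section Balanced

/-- A finitely generated projective-injective module with a nonzero map to exactly those modules
that have a nonzero map to it. Over an Artin algebra this says that the simple quotients of `Q` are,
up to isomorphism, its simple submodules. -/
structure IsBalanced (Λ : Type u) [Ring Λ] (Q : Type u) [AddCommGroup Q] [Module Λ Q] : Prop where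
  finite : Module.Finite Λ Q
  projective : Module.Projective Λ Q
  injective : Module.Injective Λ Q
  hom : ∀ X : ModuleCat.{u} Λ, Nontrivial (Q →ₗ[Λ] X) ↔ Nontrivial (X →ₗ[Λ] Q)

variable {Λ : Type u} [Ring Λ]

theorem IsBalanced.pi {ι : Type} [Fintype ι] (Q : ι → Type u) [∀ k, AddCommGroup (Q k)]
    [∀ k, Module Λ (Q k)] (h : ∀ k, IsBalanced Λ (Q k)) : IsBalanced Λ (∀ k, Q k) where
  finite := have := fun k => (h k).finite; inferInstance
  projective := projective_pi Q fun k => (h k).projective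
  injective := injective_pi Q fun k => (h k).injective
  hom X := by
    rw [nontrivial_pi_hom, nontrivial_hom_pi]
    exact exists_congr fun k => (h k).hom X

/-- Balancedness can be tested on simple modules: a nonzero map out of `Q` has a simple quotient
of its image, which embeds into the injective module `Q`, and dually. -/
theorem IsBalanced.of_simple [IsArtinianRing Λ] (Q : Type u) [AddCommGroup Q] [Module Λ Q]
    [Module.Finite Λ Q] [Module.Projective Λ Q] [hQ : Module.Injective Λ Q]
    (h : ∀ (T : Type u) [AddCommGroup T] [Module Λ T], IsSimpleModule Λ T →
      (Nontrivial (Q →ₗ[Λ] T) ↔ Nontrivial (T →ₗ[Λ] Q))) : IsBalanced Λ Q where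
  finite := inferInstance
  projective := inferInstance
  injective := inferInstance
  hom X := by
    constructor
    · intro hn
      obtain ⟨f, hf⟩ := exists_ne_zero_of_nontrivial hn
      obtain ⟨m, hm, hle⟩ := (eq_top_or_exists_le_coatom (LinearMap.ker f)).resolve_left
        fun h0 => hf (LinearMap.ker_eq_top.1 h0)
      have hs : IsSimpleModule Λ (Q ⧸ m) := isSimpleModule_iff_isCoatom.2 hm
      have hne : m.mkQ ≠ 0 := fun h0 => hm.1 (by rw [← m.ker_mkQ, h0, LinearMap.ker_zero])
      obtain ⟨g, hg⟩ := exists_ne_zero_of_nontrivial ((h _ hs).1 (nontrivial_of_ne_zero hne))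
      obtain ⟨k, hk⟩ := hQ.out (LinearMap.range f).subtype (LinearMap.range f).injective_subtype
        (g ∘ₗ (LinearMap.ker f).mapQ m LinearMap.id hle ∘ₗ f.quotKerEquivRange.symm.toLinearMap)
      refine nontrivial_of_ne_zero (f := k) fun h0 => hg (LinearMap.ext fun t => ?_)
      obtain ⟨q, rfl⟩ := m.mkQ_surjective t
      have := hk (f.quotKerEquivRange (Submodule.Quotient.mk q))
      rw [h0] at this
      simpa using this.symm
    · intro hn
      obtain ⟨f, hf⟩ := exists_ne_zero_of_nontrivial hn
      obtain ⟨T, hT, hle⟩ := (eq_bot_or_exists_atom_le (LinearMap.range f)).resolve_left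
        fun h0 => hf (LinearMap.range_eq_bot.1 h0)
      have hs : IsSimpleModule Λ T := isSimpleModule_iff_isAtom.2 hT
      have hne : T.subtype ≠ 0 := fun h0 => hT.1 (by
        rw [← T.range_subtype, h0, LinearMap.range_zero])
      obtain ⟨g, hg⟩ := exists_ne_zero_of_nontrivial ((h _ hs).2 (nontrivial_of_ne_zero hne))
      let f' : T.comap f →ₗ[Λ] T := f.restrict fun _ hx => hx
      have hf' : Function.Surjective f' := fun t => by
        obtain ⟨x, hx⟩ := hle t.2
        exact ⟨⟨x, by simp [hx]⟩, Subtype.ext hx⟩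
      obtain ⟨k, hk⟩ := Module.projective_lifting_property f' g hf'
      refine nontrivial_of_ne_zero (f := (T.comap f).subtype ∘ₗ k) fun h0 => hg ?_
      rw [← hk, show k = 0 from LinearMap.ext fun q => Subtype.ext (LinearMap.congr_fun h0 q),
        LinearMap.comp_zero]

variable {R : Type u} [CommRing R] [IsArtinianRing R] [Algebra R Λ] [Module.Finite R Λ]

/-- The Nakayama functor preserves `add Q` for balanced `Q`: the socle of `ν P` is the top of `P`,
so `ν P` embeds into a finite power of `Q`. -/
theorem IsBalanced.inAdd_nakayama {Q P : Type u} [AddCommGroup Q] [Module Λ Q]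
    [AddCommGroup P] [Module Λ P] (hQ : IsBalanced Λ Q) (hP : InAdd Λ Q P) :
    InAdd Λ Q (NakayamaCarrier R (Λ := Λ) P) := by
  have : IsArtinianRing Λ := IsArtinianRing.of_finite R Λ
  have := hQ.finite
  have := hQ.projective
  have := hQ.injective
  have := hP.finite
  have := hP.projective
  have : Module.Finite Λ (NakayamaCarrier R (Λ := Λ) P) := finite_nakayama
  have : Module.Injective Λ (NakayamaCarrier R (Λ := Λ) P) := injective_nakayama
  refine inAdd_of_socle _ _ fun T _ _ hT hn => ?_
  exact (hQ.hom (ModuleCat.of Λ T)).1 (hP.nontrivial_hom ((nontrivial_nakayama_iff T).1 hn))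

theorem IsBalanced.isNuStableProjective {Q : Type u} [AddCommGroup Q] [Module Λ Q]
    (hQ : IsBalanced Λ Q) (P : ModuleCat.{u} Λ) (hP : InAdd Λ Q P) :
    IsNuStableProjective R P := by
  have := hQ.finite
  have := hQ.projective
  refine ⟨hP.finite, hP.projective, fun i _ => ?_⟩
  suffices h : InAdd Λ Q ((nakayama R)^[i] P : ModuleCat.{u} Λ) from h.projective
  induction i with
  | zero => exact hP
  | succ i ih =>
    rw [Function.iterate_succ_apply']
    rcases i with _ | i
    · exact hQ.inAdd_nakayama hP
    · exact hQ.inAdd_nakayama (ih (Nat.succ_pos i))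

/-- Every `ν`-stable projective module is a summand of a power of a balanced module, namely of
`ν P ⊕ ⋯ ⊕ νⁿ P` for large `n`: all tops of the `νⁱ P` occur in its socle, and, by counting, in its
top. -/
theorem exists_isBalanced (P : ModuleCat.{u} Λ) (hP : IsNuStableProjective R P) :
    ∃ Q : ModuleCat.{u} Λ, IsBalanced Λ Q ∧ InAdd Λ Q P := by
  have : IsArtinianRing Λ := IsArtinianRing.of_finite R Λ
  obtain ⟨hfin, hproj, hstab⟩ := hP
  let L : ℕ → ModuleCat.{u} Λ := fun i => (nakayama R)^[i] P
  have hL : ∀ i, L (i + 1) = nakayama R (L i) := fun i => Function.iterate_succ_apply' _ _ _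
  have hLproj : ∀ i, Module.Projective Λ (L i) := fun i => by
    rcases i with _ | i
    · exact hproj
    · exact hstab _ (Nat.succ_pos i)
  have hLfin : ∀ i, Module.Finite Λ (L i) := fun i => by
    induction i with
    | zero => exact hfin
    | succ i ih =>
      rw [hL]
      exact finite_nakayama
  have hLinj : ∀ i, Module.Injective Λ (L (i + 1)) := fun i => by
    rw [hL]
    exact injective_nakayama
  have hLhom : ∀ i (T : Type u) [AddCommGroup T] [Module Λ T],
      Nontrivial (T →ₗ[Λ] L (i + 1)) ↔ Nontrivial (L i →ₗ[Λ] T) := fun i T _ _ => by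
    rw [hL]
    exact nontrivial_nakayama_iff T
  obtain ⟨m, S, hS, hall, hiso⟩ := exists_simple_representatives Λ
  let U : Set (Fin m) := {s | ∃ i, Nontrivial (L i →ₗ[Λ] S s)}
  obtain ⟨n, hn⟩ : ∃ n, ∀ s ∈ U, ∃ i < n, Nontrivial (L i →ₗ[Λ] S s) := by
    choose! i hi using fun s (hs : s ∈ U) => hs
    exact ⟨Finset.univ.sup i + 1, fun s hs =>
      ⟨i s, Nat.lt_succ_of_le (Finset.le_sup (Finset.mem_univ s)), hi s hs⟩⟩
  -- `P = L 0` itself is left out, as it need not be injective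
  let Q : Type u := ∀ k : Fin n, L (k + 1)
  have hQproj : Module.Projective Λ Q := projective_pi _ fun k => hLproj _
  have hQinj : Module.Injective Λ Q := injective_pi _ fun k => hLinj _
  have hsoc : {s | Nontrivial (S s →ₗ[Λ] Q)} = U := by
    ext s
    refine (nontrivial_hom_pi _).trans ⟨fun ⟨k, hk⟩ => ⟨k, (hLhom _ _).1 hk⟩, fun hs => ?_⟩
    obtain ⟨i, hi, h⟩ := hn s hs
    exact ⟨⟨i, hi⟩, (hLhom _ _).2 h⟩
  have htop : {s | Nontrivial (Q →ₗ[Λ] S s)} = U := by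
    refine Set.eq_of_subset_of_ncard_le (fun s hs => ?_) ?_
    · obtain ⟨k, hk⟩ := (nontrivial_pi_hom _).1 hs
      exact ⟨_, hk⟩
    · obtain ⟨φ, hφ⟩ := exists_injective_socle_to_top S hS hall hiso Q
      rw [← hsoc]
      exact Nat.card_le_card_of_injective φ hφ
  have htop' : ∀ s, Nontrivial (Q →ₗ[Λ] S s) ↔ s ∈ U := fun s => Set.ext_iff.1 htop s
  have hsoc' : ∀ s, Nontrivial (S s →ₗ[Λ] Q) ↔ s ∈ U := fun s => Set.ext_iff.1 hsoc s
  refine ⟨ModuleCat.of Λ Q, IsBalanced.of_simple Q fun T _ _ hT => ?_,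
    inAdd_of_top _ _ fun T _ _ hT hn => ?_⟩
  · obtain ⟨s, ⟨e⟩⟩ := hall T hT
    rw [nontrivial_congr_right e, nontrivial_congr_left e, htop', hsoc']
  · obtain ⟨s, ⟨e⟩⟩ := hall T hT
    rw [nontrivial_congr_right e] at hn
    exact (nontrivial_congr_right e).2 ((htop' s).2 ⟨0, hn⟩)

/-- `ν`-stable projective modules, described without reference to the base ring `R`. -/
theorem isNuStableProjective_iff (P : ModuleCat.{u} Λ) :
    IsNuStableProjective R P ↔ ∃ Q : ModuleCat.{u} Λ, IsBalanced Λ Q ∧ InAdd Λ Q P :=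
  ⟨exists_isBalanced P, fun ⟨_, hQ, hP⟩ => hQ.isNuStableProjective P hP⟩

variable (R Λ) in
/-- A generator of `Λ-stp` is a direct sum of balanced modules, one for each simple module that is
a quotient of some balanced module. -/
theorem exists_isStpGenerator : ∃ V : ModuleCat.{u} Λ, IsStpGenerator R Λ V := by
  classical
  have : IsArtinianRing Λ := IsArtinianRing.of_finite R Λ
  obtain ⟨m, S, -, hall, -⟩ := exists_simple_representatives Λ
  let ι := {s : Fin m // ∃ Q : ModuleCat.{u} Λ, IsBalanced Λ Q ∧ Nontrivial (Q →ₗ[Λ] S s)}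
  choose Q hQ hQs using fun s : ι => s.2
  let V : Type u := ∀ s : ι, Q s
  have hV : IsBalanced Λ V := IsBalanced.pi _ hQ
  have := hV.finite
  have := hV.projective
  refine ⟨ModuleCat.of Λ V, hV.finite, fun X => ?_⟩
  rw [isNuStableProjective_iff]
  refine ⟨fun ⟨Q', hQ', hX⟩ => InAdd.trans (X := Q') ?_ hX, fun hX => ⟨_, hV, hX⟩⟩
  have := hQ'.finite
  have := hQ'.projective
  refine inAdd_of_top _ _ fun T _ _ hT hn => ?_
  obtain ⟨s, ⟨e⟩⟩ := hall T hT
  rw [nontrivial_congr_right e] at hn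
  exact (nontrivial_congr_right e).2
    ((nontrivial_pi_hom _).2 ⟨⟨s, Q', hQ', hn⟩, hQs _⟩)

end Balanced

/-! ### Tensor products with bimodules -/

namespace Bimodule

variable {Λ Γ Δ : Type u} [Ring Λ] [Ring Γ] [Ring Δ]

section TensorObj

variable (M : Bimodule Λ Γ) {V W : Type u} [AddCommGroup V] [Module Γ V] [AddCommGroup W]
  [Module Γ W]

/-- The biadditive map `(m, v) ↦ m ⊗ v`. -/
def tmul : M →+ V →+ M.TensorObj V :=
  AddMonoidHom.mk' (fun m => AddMonoidHom.mk' (fun v => RingTensor.tmul Γ m v)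
    (RingTensor.tmul_add Γ m)) fun m m' => AddMonoidHom.ext fun v => RingTensor.add_tmul Γ m m' v

theorem smul_tmul (a : Λ) (m : M) (v : V) : a • M.tmul m v = M.tmul (a • m) v := rfl

theorem tmul_smul (m : M) (g : Γ) (v : V) : M.tmul (op g • m) v = M.tmul m (g • v) := by
  have h : (op g • m) ⊗ₜ[ℤ] v - m ⊗ₜ[ℤ] (g • v) ∈ balancedRel Γ M V :=
    AddSubgroup.subset_closure ⟨m, g, v, rfl⟩
  refine sub_eq_zero.1 ((map_sub (QuotientAddGroup.mk' (balancedRel Γ M V)) _ _).symm.trans ?_)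
  exact (QuotientAddGroup.eq_zero_iff _).2 h

@[simp] theorem tensorMap_tmul (f : V →ₗ[Γ] W) (m : M) (v : V) :
    M.tensorMap f (M.tmul m v) = M.tmul m (f v) := rfl

variable {M} in
@[elab_as_elim]
theorem tensorObj_induction {p : M.TensorObj V → Prop} (t : M.TensorObj V) (h0 : p 0)
    (ht : ∀ m v, p (M.tmul m v)) (ha : ∀ x y, p x → p y → p (x + y)) : p t := by
  obtain ⟨t, rfl⟩ := QuotientAddGroup.mk'_surjective (balancedRel Γ M V) t
  induction t with
  | zero => exact h0
  | tmul m n => exact ht m n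
  | add x y hx hy => exact ha _ _ hx hy

variable {M} in
theorem tensorObj_hom_ext {A : Type*} [AddCommGroup A] {f g : M.TensorObj V →+ A}
    (h : ∀ m v, f (M.tmul m v) = g (M.tmul m v)) : f = g :=
  RingTensor.hom_ext Γ h

/-- The additive map out of `M ⊗_Γ V` given by a balanced biadditive map. -/
def lift {A : Type*} [AddCommGroup A] (f : M →+ V →+ A)
    (h : ∀ m (g : Γ) v, f (op g • m) v = f m (g • v)) : M.TensorObj V →+ A :=
  QuotientAddGroup.lift (balancedRel Γ M V)
    (TensorProduct.liftAddHom f fun r m v => by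
      rw [map_zsmul, map_zsmul, AddMonoidHom.zsmul_apply]) <| by
    refine (AddSubgroup.closure_le _).2 ?_
    rintro _ ⟨m, a, v, rfl⟩
    refine (map_sub _ _ _).trans (sub_eq_zero.2 ?_)
    exact h m a v

@[simp] theorem lift_tmul {A : Type*} [AddCommGroup A] (f : M →+ V →+ A)
    (h : ∀ m (g : Γ) v, f (op g • m) v = f m (g • v)) (m : M) (v : V) :
    M.lift f h (M.tmul m v) = f m v := rfl

/-- An additive map on `M ⊗_Γ V` that is linear on pure tensors is linear. -/
def linearOfTmul {X : Type u} [AddCommGroup X] [Module Λ X] (f : M.TensorObj V →+ X)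
    (h : ∀ (a : Λ) m v, f (M.tmul (a • m) v) = a • f (M.tmul m v)) : M.TensorObj V →ₗ[Λ] X where
  toFun := f
  map_add' := map_add f
  map_smul' a t := by
    induction t using tensorObj_induction with
    | h0 => rw [smul_zero, map_zero, smul_zero]
    | ht m v => exact h a m v
    | ha x y hx hy => rw [smul_add, map_add, map_add, hx, hy, smul_add]

instance : M.tensorFunctor.Additive where
  map_add {_ _} f g := ModuleCat.hom_ext <| LinearMap.ext fun t => DFunLike.congr_fun
    (tensorObj_hom_ext (f := (M.tensorMap (f.hom + g.hom)).toAddMonoidHom)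
      (g := (M.tensorMap f.hom + M.tensorMap g.hom).toAddMonoidHom)
      fun m v => map_add (M.tmul m) (f.hom v) (g.hom v)) t

theorem finite_tensorObj [Module.Finite Λ M] [Module.Finite Γ V] :
    Module.Finite Λ (M.TensorObj V) := by
  classical
  obtain ⟨n, v, hv⟩ := Module.Finite.exists_fin (R := Γ) (M := V)
  let φ : (Fin n → M) →ₗ[Λ] M.TensorObj V := LinearMap.lsum Λ _ ℕ fun i =>
    { toFun := fun m => M.tmul m (v i)
      map_add' := fun m m' => by rw [map_add, AddMonoidHom.add_apply]
      map_smul' := fun a m => rfl }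
  have htmul : ∀ (w : V), ∀ m : M, M.tmul m w ∈ LinearMap.range φ := fun w => by
    have hw : w ∈ Submodule.span Γ (Set.range v) := hv ▸ trivial
    induction hw using Submodule.span_induction with
    | mem w hw =>
      obtain ⟨i, rfl⟩ := hw
      exact fun m => ⟨Pi.single i m, LinearMap.lsum_piSingle ..⟩
    | zero =>
      intro m
      rw [map_zero]
      exact Submodule.zero_mem _
    | add x y _ _ hx hy =>
      intro m
      rw [map_add]
      exact Submodule.add_mem _ (hx m) (hy m)
    | smul g x _ hx =>
      intro m
      rw [← tmul_smul]
      exact hx _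
  refine Module.Finite.of_surjective φ fun t => ?_
  change t ∈ LinearMap.range φ
  induction t using tensorObj_induction with
  | h0 => exact Submodule.zero_mem _
  | ht m w => exact htmul w m
  | ha x y hx hy => exact Submodule.add_mem _ hx hy

end TensorObj

section Tensor

variable (M : Bimodule Λ Γ) (N : Bimodule Γ Δ)

/-- The biadditive map `(m, n) ↦ m ⊗ n` to the bimodule `M ⊗_Γ N`. -/
def mkTensor : M →+ N →+ M.tensor N := M.tmul (V := N)

theorem smul_mkTensor (a : Λ) (m : M) (n : N) :
    a • M.mkTensor N m n = M.mkTensor N (a • m) n := rfl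

theorem op_smul_mkTensor (b : Δᵐᵒᵖ) (m : M) (n : N) :
    b • M.mkTensor N m n = M.mkTensor N m (b • n) := rfl

theorem mkTensor_smul (m : M) (g : Γ) (n : N) :
    M.mkTensor N (op g • m) n = M.mkTensor N m (g • n) := M.tmul_smul m g n

/-- The additive map out of the bimodule `M ⊗_Γ N` given by a balanced biadditive map. -/
def liftTensor {A : Type*} [AddCommGroup A] (f : M →+ N →+ A)
    (h : ∀ m (g : Γ) n, f (op g • m) n = f m (g • n)) : M.tensor N →+ A := M.lift (V := N) f h

variable {M N} in
@[elab_as_elim]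
theorem tensor_induction {p : M.tensor N → Prop} (t : M.tensor N) (h0 : p 0)
    (ht : ∀ m v, p (M.mkTensor N m v)) (ha : ∀ x y, p x → p y → p (x + y)) : p t :=
  tensorObj_induction (M := M) (V := N) (p := p) t h0 ht ha

end Tensor

section Pairing

variable {M : Bimodule Λ Γ} {N : Bimodule Γ Λ}

/-- For a biadditive pairing `p`, the map sending `m` and `n ⊗ v` to `p m n • v`. -/
def evalTensor (p : M →+ N →+ Λ) (hr : ∀ m (a : Λ) n, p m (op a • n) = p m n * a)
    (V : Type u) [AddCommGroup V] [Module Λ V] : M →+ N.TensorObj V →+ V :=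
  AddMonoidHom.mk' (fun m => N.lift ((smulAddHom Λ V).comp (p m)) fun n a v => by
      change p m (op a • n) • v = p m n • a • v
      rw [hr, mul_smul])
    fun m m' => tensorObj_hom_ext fun n v => by
      change p (m + m') n • v = p m n • v + p m' n • v
      rw [map_add, AddMonoidHom.add_apply, add_smul]

/-- A bimodule pairing `p : M ⊗_Γ N → Λ` induces `M ⊗_Γ (N ⊗_Λ V) → V`, sending `m ⊗ (n ⊗ v)` to
`p m n • v`. -/
def pairingMap (p : M →+ N →+ Λ) (hl : ∀ (a : Λ) m n, p (a • m) n = a * p m n)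
    (hb : ∀ m (b : Γ) n, p (op b • m) n = p m (b • n))
    (hr : ∀ m (a : Λ) n, p m (op a • n) = p m n * a)
    (V : Type u) [AddCommGroup V] [Module Λ V] : M.TensorObj (N.TensorObj V) →ₗ[Λ] V :=
  M.linearOfTmul (M.lift (evalTensor p hr V) fun m b t => by
      induction t using tensorObj_induction with
      | h0 => rw [smul_zero, map_zero, map_zero]
      | ht n v => exact congrArg (· • v) (hb m b n)
      | ha x y hx hy => rw [smul_add, map_add, map_add, hx, hy])
    fun a m t => by
      rw [lift_tmul, lift_tmul]
      induction t using tensorObj_induction with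
      | h0 => rw [map_zero, map_zero, smul_zero]
      | ht n v => exact (congrArg (· • v) (hl a m n)).trans (mul_smul a _ v)
      | ha x y hx hy => rw [map_add, map_add, hx, hy, smul_add]

theorem pairingMap_tmul (p : M →+ N →+ Λ) (hl : ∀ (a : Λ) m n, p (a • m) n = a * p m n)
    (hb : ∀ m (b : Γ) n, p (op b • m) n = p m (b • n))
    (hr : ∀ m (a : Λ) n, p m (op a • n) = p m n * a)
    (V : Type u) [AddCommGroup V] [Module Λ V] (m : M) (n : N) (v : V) :
    pairingMap p hl hb hr V (M.tmul m (N.tmul n v)) = p m n • v := rfl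

theorem pairingMap_naturality (p : M →+ N →+ Λ) (hl : ∀ (a : Λ) m n, p (a • m) n = a * p m n)
    (hb : ∀ m (b : Γ) n, p (op b • m) n = p m (b • n))
    (hr : ∀ m (a : Λ) n, p m (op a • n) = p m n * a)
    {V W : Type u} [AddCommGroup V] [Module Λ V] [AddCommGroup W] [Module Λ W] (f : V →ₗ[Λ] W)
    (t : M.TensorObj (N.TensorObj V)) :
    pairingMap p hl hb hr W (M.tensorMap (N.tensorMap f) t) = f (pairingMap p hl hb hr V t) := by
  induction t using tensorObj_induction with
  | h0 => simp
  | ht m t =>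
    induction t using tensorObj_induction with
    | h0 => simp
    | ht n v => simp [pairingMap_tmul]
    | ha x y hx hy => simp only [map_add, hx, hy]
  | ha x y hx hy => simp only [map_add, hx, hy]

end Pairing

/-! ### Dual bases and adjunctions -/

/-- `M` and `N` are dual bimodules: `y i` and `m ↦ π m (x i)` form a dual basis of the left
module `M`, and `x i` and `n ↦ π (y i) n` one of the right module `N`. -/
structure DualBasis (M : Bimodule Λ Γ) (N : Bimodule Γ Λ) where
  card : ℕ
  x : Fin card → N
  y : Fin card → M
  π : M →+ N →+ Λ
  smul_left : ∀ a m n, π (a • m) n = a * π m n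
  balanced : ∀ m (b : Γ) n, π (op b • m) n = π m (b • n)
  smul_right : ∀ m (a : Λ) n, π m (op a • n) = π m n * a
  sum_left : ∀ m, ∑ i, π m (x i) • y i = m
  sum_right : ∀ n, ∑ i, op (π (y i) n) • x i = n

namespace DualBasis

variable {M : Bimodule Λ Γ} {N : Bimodule Γ Λ}

theorem finite_projective_left (d : DualBasis M N) :
    Module.Finite Λ M ∧ Module.Projective Λ M := by
  have h : InAdd Λ Λ M := InAdd.of_sum
    (fun i : Fin d.card =>
      { toFun := fun m => d.π m (d.x i)
        map_add' := fun m m' => by rw [map_add, AddMonoidHom.add_apply]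
        map_smul' := fun a m => d.smul_left a m _ })
    (fun i => LinearMap.toSpanSingleton Λ M (d.y i)) (by
      ext m
      simpa [LinearMap.sum_apply] using d.sum_left m)
  exact ⟨h.finite, h.projective⟩

theorem finite_projective_right (d : DualBasis M N) :
    Module.Finite Λᵐᵒᵖ N ∧ Module.Projective Λᵐᵒᵖ N := by
  have h : InAdd Λᵐᵒᵖ Λᵐᵒᵖ N := InAdd.of_sum
    (fun i : Fin d.card =>
      { toFun := fun n => op (d.π (d.y i) n)
        map_add' := fun n n' => by rw [map_add, MulOpposite.op_add]
        map_smul' := fun a n => by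
          rw [← op_unop a, d.smul_right, op_mul, RingHom.id_apply, smul_eq_mul] })
    (fun i => LinearMap.toSpanSingleton Λᵐᵒᵖ N (d.x i)) (by
      ext n
      simpa [LinearMap.sum_apply] using d.sum_right n)
  exact ⟨h.finite, h.projective⟩

/-- The element `∑ x i ⊗ y i` of `N ⊗ M` commutes with the action of `Γ`. The tensor product over
`Λ` is represented by balanced biadditive maps `f`. -/
theorem sum_smul (d : DualBasis M N) {A : Type*} [AddCommGroup A] (f : N →+ M →+ A)
    (hf : ∀ n (a : Λ) m, f (op a • n) m = f n (a • m)) (b : Γ) :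
    ∑ i, f (b • d.x i) (d.y i) = ∑ i, f (d.x i) (op b • d.y i) := by
  calc ∑ i, f (b • d.x i) (d.y i)
      = ∑ i, ∑ j, f (op (d.π (d.y j) (b • d.x i)) • d.x j) (d.y i) := by
        refine Finset.sum_congr rfl fun i _ => ?_
        conv_lhs => rw [← d.sum_right (b • d.x i), map_sum, AddMonoidHom.finsetSum_apply]
    _ = ∑ j, ∑ i, f (d.x j) (d.π (op b • d.y j) (d.x i) • d.y i) := by
        rw [Finset.sum_comm]
        refine Finset.sum_congr rfl fun j _ => Finset.sum_congr rfl fun i _ => ?_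
        rw [hf, d.balanced]
    _ = _ := by
        refine Finset.sum_congr rfl fun j _ => ?_
        rw [← map_sum, d.sum_left]

/-- The unit `v ↦ ∑ x i ⊗ (y i ⊗ v)`. -/
def unitMap (d : DualBasis M N) (V : Type u) [AddCommGroup V] [Module Γ V] :
    V →ₗ[Γ] N.TensorObj (M.TensorObj V) where
  toFun v := ∑ i, N.tmul (d.x i) (M.tmul (d.y i) v)
  map_add' v w := by simp_rw [map_add, Finset.sum_add_distrib]
  map_smul' b v := by
    have h := d.sum_smul (N.tmul.compl₂ (M.tmul.flip v)) (fun n a m => N.tmul_smul n a (M.tmul m v)) b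
    rw [RingHom.id_apply, Finset.smul_sum]
    simp_rw [smul_tmul, ← tmul_smul]
    exact h.symm

/-- The counit `m ⊗ (n ⊗ v) ↦ π m n • v`. -/
def counitMap (d : DualBasis M N) (V : Type u) [AddCommGroup V] [Module Λ V] :
    M.TensorObj (N.TensorObj V) →ₗ[Λ] V :=
  pairingMap d.π d.smul_left d.balanced d.smul_right V

theorem counitMap_tmul (d : DualBasis M N) (V : Type u) [AddCommGroup V] [Module Λ V] (m : M) (n : N)
    (v : V) : d.counitMap V (M.tmul m (N.tmul n v)) = d.π m n • v := rfl

/-- A dual basis makes `M ⊗_Γ -` left adjoint to `N ⊗_Λ -`. -/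
def adjunction (d : DualBasis M N) : M.tensorFunctor ⊣ N.tensorFunctor :=
  Adjunction.mkOfUnitCounit
    { unit :=
        { app := fun V => ModuleCat.ofHom (d.unitMap V)
          naturality := fun V W f => ModuleCat.hom_ext <| LinearMap.ext fun v => by
            change ∑ i, N.tmul (d.x i) (M.tmul (d.y i) (f.hom v)) =
              N.tensorMap (M.tensorMap f.hom) (∑ i, N.tmul (d.x i) (M.tmul (d.y i) v))
            simp }
      counit :=
        { app := fun V => ModuleCat.ofHom (d.counitMap V)
          naturality := fun _ _ f => ModuleCat.hom_ext <| LinearMap.ext fun t =>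
            pairingMap_naturality d.π d.smul_left d.balanced d.smul_right f.hom t }
      left_triangle := by
        ext V t
        change d.counitMap _ (M.tensorMap (d.unitMap V) t) = t
        induction t using tensorObj_induction with
        | h0 => simp
        | ht m v =>
          have : M.tensorMap (d.unitMap V) (M.tmul m v) =
            ∑ i, M.tmul m (N.tmul (d.x i) (M.tmul (d.y i) v)) := by
            rw [tensorMap_tmul]
            exact map_sum (M.tmul (V := N.TensorObj (M.TensorObj V)) m)
              (fun i => N.tmul (d.x i) (M.tmul (d.y i) v)) Finset.univ
          rw [this, map_sum]
          simp_rw [counitMap_tmul, smul_tmul]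
          rw [← AddMonoidHom.finsetSum_apply, ← map_sum, d.sum_left]
        | ha x y hx hy => simp only [map_add, hx, hy]
      right_triangle := by
        ext V t
        change N.tensorMap (d.counitMap V) (d.unitMap _ t) = t
        induction t using tensorObj_induction with
        | h0 => simp
        | ht n v =>
          have : d.unitMap _ (N.tmul n v) = ∑ i, N.tmul (d.x i) (M.tmul (d.y i) (N.tmul n v)) := rfl
          rw [this, map_sum]
          simp_rw [tensorMap_tmul, counitMap_tmul, ← tmul_smul]
          rw [← AddMonoidHom.finsetSum_apply, ← map_sum, d.sum_right]
        | ha x y hx hy => simp only [map_add, hx, hy] }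

end DualBasis

/-! ### Split bimodules -/

/-- A bimodule retraction `r` onto `Λ` splits off a copy of `Λ`; a section is given by an element
that commutes with `Λ`. -/
theorem exists_isIsomorphic_self_prod (T : Bimodule Λ Λ) (r : T →+ Λ)
    (hl : ∀ (a : Λ) t, r (a • t) = a * r t) (hr : ∀ (a : Λ) t, r (op a • t) = r t * a) (t₀ : T)
    (hcomm : ∀ a : Λ, a • t₀ = op a • t₀) (h1 : r t₀ = 1) :
    ∃ X : Bimodule Λ Λ, T.IsIsomorphic ((Bimodule.self Λ).prod X) := by
  let K : Submodule Λ T := LinearMap.ker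
    ({ toFun := r, map_add' := map_add r, map_smul' := hl } : T →ₗ[Λ] Λ)
  let _ : Module Λᵐᵒᵖ K :=
    { smul := fun b k => ⟨b • k.1, by
        have hk : r k = 0 := k.2
        change r (op (unop b) • k.1) = 0
        rw [hr, hk, zero_mul]⟩
      one_smul := fun k => Subtype.ext (one_smul _ k.1)
      mul_smul := fun b c k => Subtype.ext (mul_smul b c k.1)
      smul_zero := fun b => Subtype.ext (smul_zero b)
      smul_add := fun b k l => Subtype.ext (smul_add b k.1 l.1)
      add_smul := fun b c k => Subtype.ext (add_smul b c k.1)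
      zero_smul := fun k => Subtype.ext (zero_smul _ k.1) }
  have : SMulCommClass Λ Λᵐᵒᵖ K := ⟨fun a b t => Subtype.ext (smul_comm a b t.1)⟩
  let X : Bimodule Λ Λ := { carrier := K }
  refine ⟨X, ?_⟩
  let f : T →ₗ[Λ] Λ × K :=
    { toFun := fun t => (r t, ⟨t - r t • t₀, by
        change r (t - r t • t₀) = 0
        rw [map_sub, hl, h1, mul_one, sub_self]⟩)
      map_add' := fun s t => by
        refine Prod.ext (map_add r s t) (Subtype.ext ?_)
        change s + t - r (s + t) • t₀ = (s - r s • t₀) + (t - r t • t₀)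
        rw [map_add, add_smul]
        abel
      map_smul' := fun a t => by
        refine Prod.ext (hl a t) (Subtype.ext ?_)
        change a • t - r (a • t) • t₀ = a • (t - r t • t₀)
        rw [hl, smul_sub, mul_smul] }
  let e : T ≃ₗ[Λ] Λ × K := LinearEquiv.ofBijective f <| by
    constructor
    · intro s t h
      have h1 : r s = r t := congrArg Prod.fst h
      have h2 : s - r s • t₀ = t - r t • t₀ := congrArg (fun z => (Prod.snd z).1) h
      rwa [h1, sub_left_inj] at h2
    · rintro ⟨a, k, hk⟩
      have hk' : r k = 0 := hk
      have hrk : r (a • t₀ + k) = a := by rw [map_add, hl, h1, mul_one, hk', add_zero]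
      refine ⟨a • t₀ + k, Prod.ext hrk (Subtype.ext ?_)⟩
      change a • t₀ + k - r (a • t₀ + k) • t₀ = k
      rw [hrk, add_sub_cancel_left]
  refine ⟨e, fun b t => Prod.ext (hr (unop b) t) (Subtype.ext ?_)⟩
  change b • t - r (b • t) • t₀ = b • (t - r t • t₀)
  rw [smul_sub, ← op_unop b, hr, mul_smul, hcomm, smul_comm]

/-- If `Λ` is a direct summand of the bimodule `M ⊗_Γ N`, then the identity is a natural direct
summand of `M ⊗_Γ (N ⊗_Λ -)`. -/
theorem exists_natTrans_retraction (M : Bimodule Λ Γ) (N : Bimodule Γ Λ) (X : Bimodule Λ Λ)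
    (h : (M.tensor N).IsIsomorphic ((Bimodule.self Λ).prod X)) :
    ∃ (σ : 𝟭 (ModuleCat.{u} Λ) ⟶ N.tensorFunctor ⋙ M.tensorFunctor)
      (ρ : N.tensorFunctor ⋙ M.tensorFunctor ⟶ 𝟭 (ModuleCat.{u} Λ)), σ ≫ ρ = 𝟙 _ := by
  obtain ⟨e, he⟩ := h
  let r : M.tensor N →+ Λ :=
    (AddMonoidHom.fst Λ X).comp (e : M.tensor N →+ (Bimodule.self Λ).prod X)
  have hrl : ∀ (a : Λ) t, r (a • t) = a * r t := fun a t => congrArg Prod.fst (map_smul e a t)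
  have hrr : ∀ (a : Λ) t, r (op a • t) = r t * a := fun a t => congrArg Prod.fst (he (op a) t)
  let t₀ : M.tensor N := e.symm ((1, 0) : Λ × X)
  have hr1 : r t₀ = 1 := congrArg Prod.fst (e.apply_symm_apply ((1, 0) : Λ × X))
  have het : e t₀ = ((1, 0) : Λ × X) := e.apply_symm_apply _
  have hcomm : ∀ a : Λ, a • t₀ = op a • t₀ := fun a => e.injective <| by
    rw [map_smul, he, het]
    refine Prod.ext ?_ ?_
    · exact (mul_one a).trans (one_mul a).symm
    · exact (smul_zero a).trans (smul_zero (op a)).symm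
  -- `(m ⊗ n, v) ↦ m ⊗ (n ⊗ v)`
  let act : ∀ (V : ModuleCat.{u} Λ), M.tensor N →+ (V →+ M.TensorObj (N.TensorObj V)) :=
    fun V => M.liftTensor N (AddMonoidHom.mk'
      (fun m => (AddMonoidHom.compHom (M.tmul m)).comp N.tmul)
      fun m m' => AddMonoidHom.ext fun n => AddMonoidHom.ext fun v => by simp)
      fun m g n => AddMonoidHom.ext fun v => M.tmul_smul m g (N.tmul n v)
  have act_tmul : ∀ V m n v, act V (M.mkTensor N m n) v = M.tmul m (N.tmul n v) := fun _ _ _ _ => rfl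
  have act_smul : ∀ V (a : Λ) t v, act V (a • t) v = a • act V t v := fun V a t v => by
    induction t using tensor_induction with
    | h0 => simp
    | ht m n => rfl
    | ha x y hx hy => simp only [smul_add, map_add, AddMonoidHom.add_apply, hx, hy]
  have act_op_smul : ∀ V (a : Λ) t v, act V (op a • t) v = act V t (a • v) := fun V a t v => by
    induction t using tensor_induction with
    | h0 => simp
    | ht m n =>
      rw [op_smul_mkTensor, act_tmul, act_tmul, tmul_smul]
    | ha x y hx hy => simp only [smul_add, map_add, AddMonoidHom.add_apply, hx, hy]
  have act_nat : ∀ (V W : ModuleCat.{u} Λ) (f : V →ₗ[Λ] W) t v,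
      act W t (f v) = M.tensorMap (N.tensorMap f) (act V t v) := fun V W f t v => by
    induction t using tensor_induction with
    | h0 => simp
    | ht m n => rfl
    | ha x y hx hy => simp only [map_add, AddMonoidHom.add_apply, hx, hy]
  let σ : ∀ V : ModuleCat.{u} Λ, V →ₗ[Λ] M.TensorObj (N.TensorObj V) := fun V =>
    { toFun := act V t₀
      map_add' := map_add _
      map_smul' := fun a v => by rw [← act_op_smul, ← hcomm, act_smul, RingHom.id_apply] }
  let p : M →+ N →+ Λ := AddMonoidHom.mk' (fun m => r.comp (M.mkTensor N m)) fun m m' =>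
    AddMonoidHom.ext fun n => by simp
  have hpl : ∀ (a : Λ) m n, p (a • m) n = a * p m n := fun a m n => hrl a (M.mkTensor N m n)
  have hpb : ∀ m (b : Γ) n, p (op b • m) n = p m (b • n) :=
    fun m b n => congrArg r (M.mkTensor_smul N m b n)
  have hpr : ∀ m (a : Λ) n, p m (op a • n) = p m n * a := fun m a n => hrr a (M.mkTensor N m n)
  let ρ : ∀ V : ModuleCat.{u} Λ, M.TensorObj (N.TensorObj V) →ₗ[Λ] V := fun V =>
    pairingMap p hpl hpb hpr V
  have ρ_act : ∀ V t v, ρ V (act V t v) = r t • v := fun V t v => by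
    induction t using tensor_induction with
    | h0 => simp
    | ht m n => rfl
    | ha x y hx hy => simp only [map_add, AddMonoidHom.add_apply, hx, hy, add_smul]
  refine ⟨{ app := fun V => ModuleCat.ofHom (σ V), naturality := fun V W f =>
      ModuleCat.hom_ext <| LinearMap.ext fun v => act_nat V W f.hom t₀ v },
    { app := fun V => ModuleCat.ofHom (ρ V), naturality := fun V W f =>
      ModuleCat.hom_ext <| LinearMap.ext fun t =>
        pairingMap_naturality p hpl hpb hpr f.hom t }, ?_⟩
  ext V v
  change ρ V (act V t₀ v) = v
  rw [ρ_act, hr1, one_smul]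

end Bimodule

/-! ### Functors preserving balanced modules -/

/-- A functor with the same left and right adjoint `G` preserves balanced modules: `Hom(F Q, X)` and
`Hom(X, F Q)` are `Hom(Q, G X)` and `Hom(G X, Q)`. -/
theorem IsBalanced.map {Λ Γ : Type u} [Ring Λ] [Ring Γ] {F : ModuleCat.{u} Γ ⥤ ModuleCat.{u} Λ}
    {G : ModuleCat.{u} Λ ⥤ ModuleCat.{u} Γ} (adj : F ⊣ G) (adj' : G ⊣ F)
    (Q : ModuleCat.{u} Γ) (hQ : IsBalanced Γ Q) (hF : Module.Finite Λ (F.obj Q)) :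
    IsBalanced Λ (F.obj Q) where
  finite := hF
  projective := by
    have : G.PreservesEpimorphisms := G.preservesEpimorphisms_of_adjunction adj'
    exact (IsProjective.iff_projective _).2
      (adj.map_projective Q ((IsProjective.iff_projective _).1 hQ.projective))
  injective := by
    have : G.PreservesMonomorphisms := G.preservesMonomorphisms_of_adjunction adj
    exact (Module.injective_iff_injective_object Λ _).2
      (adj'.map_injective Q ((Module.injective_iff_injective_object Γ _).1 hQ.injective))
  hom X := by
    rw [← ModuleCat.homEquiv.nontrivial_congr, ← ModuleCat.homEquiv.nontrivial_congr,
      (adj.homEquiv Q X).nontrivial_congr, ← (adj'.homEquiv X Q).nontrivial_congr,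
      ModuleCat.homEquiv.nontrivial_congr, ModuleCat.homEquiv.nontrivial_congr]
    exact hQ.hom (G.obj X)

theorem InAdd.map {Λ Γ : Type u} [Ring Λ] [Ring Γ] (F : ModuleCat.{u} Γ ⥤ ModuleCat.{u} Λ)
    [F.Additive] {V X : ModuleCat.{u} Γ} (h : InAdd Γ V X) : InAdd Λ (F.obj V) (F.obj X) := by
  obtain ⟨n, a, b, hab⟩ := h.exists_sum
  refine InAdd.of_sum (fun i => (F.map (ModuleCat.ofHom (a i))).hom)
    (fun i => (F.map (ModuleCat.ofHom (b i))).hom) ?_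
  have hab' : ∑ i, ModuleCat.ofHom (a i) ≫ ModuleCat.ofHom (b i) = 𝟙 X := by
    apply ModuleCat.hom_ext
    rw [ModuleCat.hom_sum]
    exact hab
  have := congrArg F.map hab'
  rw [F.map_sum, F.map_id] at this
  have := congrArg ModuleCat.Hom.hom this
  rw [ModuleCat.hom_sum] at this
  simpa using this

/-! ### The bimodules `Hom(V, F W)` -/

/-- An element of `End(V)`, acting on `V` from the right, as a morphism. The product in `EndAlg`
is composition in diagrammatic order. -/
def EndAlg.hom {Λ : Type u} [Ring Λ] {V : ModuleCat.{u} Λ} (a : EndAlg Λ V) : V ⟶ V :=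
  ModuleCat.ofHom (unop a)

section HomBimodule

variable {Λ Γ : Type u} [Ring Λ] [Ring Γ]

/-- A morphism `V ⟶ V` as an element of `End(V)`. -/
def EndAlg.ofHom {V : ModuleCat.{u} Λ} : (V ⟶ V) →+ EndAlg Λ V where
  toFun f := op f.hom
  map_zero' := rfl
  map_add' _ _ := rfl

/-- The `End(V)`-`End(W)`-bimodule `Hom_Λ(V, F W)` of an additive functor `F`. -/
def homBimodule (F : ModuleCat.{u} Γ ⥤ ModuleCat.{u} Λ) [F.Additive] (V : ModuleCat.{u} Λ)
    (W : ModuleCat.{u} Γ) : Bimodule (EndAlg Λ V) (EndAlg Γ W) :=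
  letI : Module (EndAlg Λ V) (V ⟶ F.obj W) :=
    { smul := fun a f => a.hom ≫ f
      one_smul := fun f => Category.id_comp f
      mul_smul := fun a b f => Category.assoc a.hom b.hom f
      smul_zero := fun _ => Limits.comp_zero
      smul_add := fun a f g => Preadditive.comp_add _ _ _ a.hom f g
      add_smul := fun a b f => Preadditive.add_comp _ _ _ a.hom b.hom f
      zero_smul := fun _ => Limits.zero_comp }
  letI : Module (EndAlg Γ W)ᵐᵒᵖ (V ⟶ F.obj W) :=
    { smul := fun b f => f ≫ F.map (unop b).hom
      one_smul := fun f => (congrArg (f ≫ ·) (F.map_id W)).trans (Category.comp_id f)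
      mul_smul := fun a b f => (congrArg (f ≫ ·) (F.map_comp (unop b).hom (unop a).hom)).trans
        (Category.assoc _ _ _).symm
      smul_zero := fun _ => Limits.zero_comp
      smul_add := fun _ f g => Preadditive.add_comp _ _ _ f g _
      add_smul := fun a b f => (congrArg (f ≫ ·)
        (F.map_add (f := (unop a).hom) (g := (unop b).hom))).trans (Preadditive.comp_add _ _ _ f _ _)
      zero_smul := fun f => (congrArg (f ≫ ·) (F.map_zero W W)).trans Limits.comp_zero }
  { carrier := V ⟶ F.obj W
    smulComm := ⟨fun _ _ f => (Category.assoc _ f _).symm⟩ }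

theorem InAdd.exists_sum_hom {V X : ModuleCat.{u} Λ} (h : InAdd Λ V X) :
    ∃ (n : ℕ) (a : Fin n → (X ⟶ V)) (b : Fin n → (V ⟶ X)), ∑ i, a i ≫ b i = 𝟙 X := by
  obtain ⟨n, a, b, hab⟩ := h.exists_sum
  refine ⟨n, fun i => ModuleCat.ofHom (a i), fun i => ModuleCat.ofHom (b i),
    ModuleCat.hom_ext ?_⟩
  rw [ModuleCat.hom_sum]
  exact hab

variable {F : ModuleCat.{u} Γ ⥤ ModuleCat.{u} Λ} {G : ModuleCat.{u} Λ ⥤ ModuleCat.{u} Γ}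
  [F.Additive] [G.Additive] {V : ModuleCat.{u} Λ} {W : ModuleCat.{u} Γ}

variable (F G V W) in
/-- The composition pairing `(f, g) ↦ f ≫ F g` followed by a map `F (G V) ⟶ V`. -/
def homPairing (c : F.obj (G.obj V) ⟶ V) :
    homBimodule F V W →+ homBimodule G W V →+ EndAlg Λ V :=
  AddMonoidHom.mk' (fun f : V ⟶ F.obj W => AddMonoidHom.mk'
      (fun g : W ⟶ G.obj V => EndAlg.ofHom (f ≫ F.map g ≫ c)) fun g g' => by
        rw [← map_add]
        congr 1
        exact (congrArg (fun k => f ≫ k ≫ c) F.map_add).trans (by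
          rw [Preadditive.add_comp, Preadditive.comp_add]))
    fun f f' => AddMonoidHom.ext fun (g : W ⟶ G.obj V) => by
      change EndAlg.ofHom ((f + f' : V ⟶ F.obj W) ≫ F.map g ≫ c) =
        EndAlg.ofHom (f ≫ F.map g ≫ c) + EndAlg.ofHom (f' ≫ F.map g ≫ c)
      rw [← map_add]
      congr 1
      exact Preadditive.add_comp _ _ _ _ _ _

theorem homPairing_smul_left (c : F.obj (G.obj V) ⟶ V) (a : EndAlg Λ V) (f : homBimodule F V W)
    (g : homBimodule G W V) : homPairing F G V W c (a • f) g = a * homPairing F G V W c f g := by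
  revert f g
  intro (f : V ⟶ F.obj W) (g : W ⟶ G.obj V)
  exact congrArg EndAlg.ofHom (Category.assoc a.hom f (F.map g ≫ c))

theorem homPairing_balanced (c : F.obj (G.obj V) ⟶ V) (f : homBimodule F V W) (b : EndAlg Γ W)
    (g : homBimodule G W V) :
    homPairing F G V W c (op b • f) g = homPairing F G V W c f (b • g) := by
  revert f g
  intro (f : V ⟶ F.obj W) (g : W ⟶ G.obj V)
  change EndAlg.ofHom ((f ≫ F.map b.hom) ≫ F.map g ≫ c) =
    EndAlg.ofHom (f ≫ F.map (b.hom ≫ g) ≫ c)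
  rw [F.map_comp, Category.assoc, Category.assoc]

theorem homPairing_smul_right (c : G ⋙ F ⟶ 𝟭 _) (f : homBimodule F V W) (a : EndAlg Λ V)
    (g : homBimodule G W V) :
    homPairing F G V W (c.app V) f (op a • g) = homPairing F G V W (c.app V) f g * a := by
  revert f g
  intro (f : V ⟶ F.obj W) (g : W ⟶ G.obj V)
  change EndAlg.ofHom (f ≫ F.map (g ≫ G.map a.hom) ≫ c.app V) =
    EndAlg.ofHom ((f ≫ F.map g ≫ c.app V) ≫ a.hom)
  have h : F.map (G.map a.hom) ≫ c.app V = c.app V ≫ a.hom := c.naturality a.hom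
  rw [F.map_comp, Category.assoc, Category.assoc, Category.assoc, h]

/-- An adjunction `F ⊣ G` makes the bimodules `Hom(V, F W)` and `Hom(W, G V)` dual to each other if
`F W` is a summand of a power of `V`. -/
theorem nonempty_dualBasis (adj : F ⊣ G) (h : InAdd Λ V (F.obj W)) :
    Nonempty (Bimodule.DualBasis (homBimodule F V W) (homBimodule G W V)) := by
  obtain ⟨n, p, m, hpm⟩ := h.exists_sum_hom
  refine ⟨{
    card := n
    x := fun i => (adj.unit.app W ≫ G.map (p i) : W ⟶ G.obj V)
    y := m
    π := homPairing F G V W (adj.counit.app V)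
    smul_left := homPairing_smul_left _
    balanced := homPairing_balanced _
    smul_right := homPairing_smul_right adj.counit
    sum_left := fun f => ?_
    sum_right := fun g => ?_ }⟩
  · revert f
    intro (f : V ⟶ F.obj W)
    change ∑ i, (f ≫ F.map (adj.unit.app W ≫ G.map (p i)) ≫ adj.counit.app V) ≫ m i = f
    have key : ∀ i, (f ≫ F.map (adj.unit.app W ≫ G.map (p i)) ≫
        adj.counit.app V) ≫ m i = f ≫ p i ≫ m i := fun i => by
      simp
    rw [Finset.sum_congr rfl fun i _ => key i, ← Preadditive.comp_sum, hpm]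
    exact Category.comp_id _
  · revert g
    intro (g : W ⟶ G.obj V)
    change ∑ i, (adj.unit.app W ≫ G.map (p i)) ≫ G.map (m i ≫ F.map g ≫
      adj.counit.app V) = g
    have key : ∀ i, (adj.unit.app W ≫ G.map (p i)) ≫ G.map (m i ≫ F.map g ≫
        adj.counit.app V) = adj.unit.app W ≫ G.map (p i ≫ m i) ≫ G.map (F.map g ≫
          adj.counit.app V) := fun i => by
      simp only [G.map_comp, Category.assoc]
    rw [Finset.sum_congr rfl fun i _ => key i, ← Preadditive.comp_sum, ← Preadditive.sum_comp,
      ← G.map_sum, hpm]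
    simp

/-- A natural retraction of `F G` onto the identity splits `End(V)` off the bimodule
`Hom(V, F W) ⊗ Hom(W, G V)` if `G V` is a summand of a power of `W`: this bimodule is
`Hom(V, F G V)`. -/
theorem exists_homBimodule_split (σ : 𝟭 (ModuleCat.{u} Λ) ⟶ G ⋙ F)
    (ρ : G ⋙ F ⟶ 𝟭 (ModuleCat.{u} Λ)) (hσρ : σ ≫ ρ = 𝟙 _) (h : InAdd Γ W (G.obj V)) :
    ∃ X : Bimodule (EndAlg Λ V) (EndAlg Λ V),
      ((homBimodule F V W).tensor (homBimodule G W V)).IsIsomorphic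
        ((Bimodule.self (EndAlg Λ V)).prod X) := by
  obtain ⟨n, q, j, hqj⟩ := h.exists_sum_hom
  let M := homBimodule F V W
  let N := homBimodule G W V
  let m : Fin n → M := fun k => (σ.app V ≫ F.map (q k) : V ⟶ F.obj W)
  let j' : Fin n → N := j
  let r : M.tensor N →+ EndAlg Λ V :=
    M.liftTensor N (homPairing F G V W (ρ.app V)) (homPairing_balanced _)
  refine Bimodule.exists_isIsomorphic_self_prod _ r (fun a t => ?_) (fun a t => ?_)
    (∑ k, M.mkTensor N (m k) (j' k)) (fun a => ?_) ?_
  · induction t using Bimodule.tensor_induction with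
    | h0 => rw [smul_zero, map_zero, mul_zero]
    | ht f g => exact homPairing_smul_left _ _ _ _
    | ha x y hx hy => rw [smul_add, map_add, map_add, hx, hy, mul_add]
  · induction t using Bimodule.tensor_induction with
    | h0 => rw [smul_zero, map_zero, zero_mul]
    | ht f g => exact homPairing_smul_right ρ _ _ _
    | ha x y hx hy => rw [smul_add, map_add, map_add, hx, hy, add_mul]
  · -- both sides are the preimage of `a.hom ≫ σ.app V : V ⟶ F (G V)`
    have hq : ∀ k, a • m k = ∑ l, op (EndAlg.ofHom (j l ≫ G.map a.hom ≫ q k)) • m l := fun k => by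
      change a.hom ≫ σ.app V ≫ F.map (q k) =
        ∑ l, (σ.app V ≫ F.map (q l)) ≫ F.map (j l ≫ G.map a.hom ≫ q k)
      have key : ∀ l, (σ.app V ≫ F.map (q l)) ≫ F.map (j l ≫ G.map a.hom ≫ q k) =
          σ.app V ≫ F.map (q l ≫ j l) ≫ F.map (G.map a.hom ≫ q k) := fun l => by
        simp only [F.map_comp, Category.assoc]
      rw [Finset.sum_congr rfl fun l _ => key l, ← Preadditive.comp_sum, ← Preadditive.sum_comp,
        ← F.map_sum, hqj, F.map_id]
      refine (σ.naturality_assoc a.hom (F.map (q k))).trans ?_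
      rw [F.map_comp]
      exact congrArg (σ.app V ≫ ·) (Category.id_comp _).symm
    have hj : ∀ l, op a • j' l = ∑ k, EndAlg.ofHom (j l ≫ G.map a.hom ≫ q k) • j' k := fun l => by
      change j l ≫ G.map a.hom = ∑ k, (j l ≫ G.map a.hom ≫ q k) ≫ j k
      have key : ∀ k, (j l ≫ G.map a.hom ≫ q k) ≫ j k = (j l ≫ G.map a.hom) ≫ q k ≫ j k :=
        fun k => by simp only [Category.assoc]
      rw [Finset.sum_congr rfl fun k _ => key k, ← Preadditive.comp_sum, hqj, Category.comp_id]
    rw [Finset.smul_sum, Finset.smul_sum]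
    simp_rw [Bimodule.smul_mkTensor, Bimodule.op_smul_mkTensor, hq, hj, map_sum,
      AddMonoidHom.finsetSum_apply, Bimodule.mkTensor_smul]
    exact Finset.sum_comm
  · rw [map_sum]
    change ∑ k, EndAlg.ofHom ((σ.app V ≫ F.map (q k)) ≫ F.map (j k) ≫ ρ.app V) = 1
    have key : ∀ k, (σ.app V ≫ F.map (q k)) ≫ F.map (j k) ≫ ρ.app V =
        σ.app V ≫ F.map (q k ≫ j k) ≫ ρ.app V := fun k => by
      simp only [F.map_comp, Category.assoc]
    rw [← map_sum, Finset.sum_congr rfl fun k _ => key k, ← Preadditive.comp_sum,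
      ← Preadditive.sum_comp, ← F.map_sum, hqj, F.map_id]
    exact congrArg EndAlg.ofHom ((congrArg (σ.app V ≫ ·) (Category.id_comp _)).trans
      (congrArg (fun τ => NatTrans.app τ V) hσρ))

end HomBimodule

/-! ### Transfer to Frobenius parts -/

section Transfer

variable {Λ Γ : Type u} [Ring Λ] [Ring Γ]

theorem DefineSymmSepEquiv.symm {M : Bimodule Λ Γ} {N : Bimodule Γ Λ}
    (h : DefineSymmSepEquiv M N) : DefineSymmSepEquiv N M :=
  ⟨h.fgProj_right, h.fgProj_left, h.split_right, h.split_left, h.adj', h.adj⟩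

/-- A symmetrical separable equivalence restricts to the endomorphism algebras of two modules
whose additive closures correspond to each other. -/
theorem DefineSymmSepEquiv.homBimodule {M : Bimodule Λ Γ} {N : Bimodule Γ Λ}
    (h : DefineSymmSepEquiv M N) {V : ModuleCat.{u} Λ} {W : ModuleCat.{u} Γ}
    (hV : InAdd Λ V (M.tensorFunctor.obj W)) (hW : InAdd Γ W (N.tensorFunctor.obj V)) :
    DefineSymmSepEquiv (homBimodule M.tensorFunctor V W) (homBimodule N.tensorFunctor W V) := by
  obtain ⟨adj⟩ := h.adj
  obtain ⟨adj'⟩ := h.adj'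
  obtain ⟨d⟩ := nonempty_dualBasis adj hV
  obtain ⟨d'⟩ := nonempty_dualBasis adj' hW
  obtain ⟨X, hX⟩ := h.split_left
  obtain ⟨Y, hY⟩ := h.split_right
  obtain ⟨σ, ρ, hσρ⟩ := Bimodule.exists_natTrans_retraction M N X hX
  obtain ⟨σ', ρ', hσρ'⟩ := Bimodule.exists_natTrans_retraction N M Y hY
  exact
    { fgProj_left := ⟨d.finite_projective_left, d'.finite_projective_right⟩
      fgProj_right := ⟨d'.finite_projective_left, d.finite_projective_right⟩
      split_left := exists_homBimodule_split σ ρ hσρ hW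
      split_right := exists_homBimodule_split σ' ρ' hσρ' hV
      adj := ⟨d.adjunction⟩
      adj' := ⟨d'.adjunction⟩ }

/-- If `R` acts centrally on `M`, then it acts on `M ⊗ W` through `M` in the same way as through
`W`; so it acts centrally on `Hom(V, M ⊗ W)`. -/
theorem isCentralOver_homBimodule {R : Type u} [CommRing R] [Algebra R Λ] [Algebra R Γ]
    {M : Bimodule Λ Γ} (hM : M.IsCentralOver R) (V W : Type u) [AddCommGroup V] [Module Λ V]
    [Module R V] [IsScalarTower R Λ V] [AddCommGroup W] [Module Γ W] [Module R W]
    [IsScalarTower R Γ W] :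
    Bimodule.IsCentralOver (Λ := EndAlg Λ V) (Γ := EndAlg Γ W) R
      (homBimodule M.tensorFunctor (ModuleCat.of Λ V) (ModuleCat.of Γ W)) := by
  intro r f
  let f' : V →ₗ[Λ] M.TensorObj W := ModuleCat.Hom.hom f
  let s : W →ₗ[Γ] W := algebraMap R (Module.End Γ W) r
  have key : ∀ t : M.TensorObj W, algebraMap R Λ r • t = M.tensorMap s t := fun t => by
    induction t using Bimodule.tensorObj_induction with
    | h0 => rw [smul_zero, map_zero]
    | ht m w =>
      rw [Bimodule.smul_tmul, hM, Bimodule.tmul_smul, Bimodule.tensorMap_tmul, algebraMap_smul]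
      rfl
    | ha x y hx hy => rw [smul_add, map_add, hx, hy]
  refine ModuleCat.hom_ext (LinearMap.ext fun v => ?_)
  change f' (r • v) = M.tensorMap s (f' v)
  rw [← key, ← algebraMap_smul Λ r v, map_smul]

theorem DefineSymmSepEquiv.isNuStableProjective {R : Type u} [CommRing R] [IsArtinianRing R]
    [Algebra R Λ] [Module.Finite R Λ] [Algebra R Γ] [Module.Finite R Γ]
    {M : Bimodule Λ Γ} {N : Bimodule Γ Λ} (h : DefineSymmSepEquiv M N) (P : ModuleCat.{u} Γ)
    (hP : IsNuStableProjective R P) : IsNuStableProjective R (M.tensorFunctor.obj P) := by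
  obtain ⟨adj⟩ := h.adj
  obtain ⟨adj'⟩ := h.adj'
  rw [isNuStableProjective_iff] at hP ⊢
  obtain ⟨Q, hQ, hQP⟩ := hP
  have := h.fgProj_left.1.1
  have := hQ.finite
  exact ⟨M.tensorFunctor.obj Q, hQ.map adj adj' Q M.finite_tensorObj, hQP.map M.tensorFunctor⟩

theorem DefineSymmSepEquiv.inAdd {R : Type u} [CommRing R] [IsArtinianRing R]
    [Algebra R Λ] [Module.Finite R Λ] [Algebra R Γ] [Module.Finite R Γ]
    {M : Bimodule Λ Γ} {N : Bimodule Γ Λ} (h : DefineSymmSepEquiv M N) {V W : Type u}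
    [AddCommGroup V] [Module Λ V] [AddCommGroup W] [Module Γ W] (hV : IsStpGenerator R Λ V)
    (hW : IsStpGenerator R Γ W) : InAdd Λ V (M.tensorFunctor.obj (ModuleCat.of Γ W)) :=
  (hV.2 _).1 (h.isNuStableProjective (R := R) _ ((hW.2 (ModuleCat.of Γ W)).2 InAdd.refl))

/-- If `Γ`-modules are natural summands of `N ⊗ M ⊗ -`, then every indecomposable `Γ`-module is a
summand of `N ⊗ Z` for an indecomposable `Λ`-module `Z`. -/
theorem IsRepresentationFinite.of_symmSepEquiv [IsArtinianRing Λ] [IsArtinianRing Γ]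
    (h : SymmSepEquiv Λ Γ) (hΛ : IsRepresentationFinite Λ) : IsRepresentationFinite Γ := by
  obtain ⟨M, N, h⟩ := h
  obtain ⟨n, X, hX⟩ := hΛ
  obtain ⟨Y, hY⟩ := h.split_right
  obtain ⟨σ, ρ, hσρ⟩ := Bimodule.exists_natTrans_retraction N M Y hY
  have := h.fgProj_left.1.1
  have := h.fgProj_right.1.1
  -- the `X i` that are not finitely generated, and so play no role, are discarded
  classical
  let I := {i : Fin n // Module.Finite Λ (X i)}
  have key : ∀ i : I, HasIndecomposableDecomposition Γ (N.TensorObj (X i.1)) := fun i => by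
    have := i.2
    have : Module.Finite Γ (N.TensorObj (X i.1)) := N.finite_tensorObj
    exact hasIndecomposableDecomposition _
  choose ι hι T a b hT hab hs using key
  -- the list for `Γ` consists of the indecomposable summands of the modules `N ⊗ X i`
  let e := Fintype.equivFin (Σ i : I, ι i)
  refine ⟨_, fun k => T (e.symm k).1 (e.symm k).2, fun Z hZ hZi => ?_⟩
  have := hZ
  have hlocal : IsLocalRing (Module.End Γ Z) := isLocalRing_end hZi
  have : Module.Finite Λ (M.TensorObj Z) := M.finite_tensorObj
  obtain ⟨κ, _, U, c, d, hU, hcd, hsum⟩ := hasIndecomposableDecomposition (Λ := Λ) (M.TensorObj Z)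
  have hUfin : ∀ k, Module.Finite Λ (U k) := fun k =>
    (InAdd.of_retract (d k) (c k) (hcd k)).finite
  choose i₀ hi₀ using fun k => hX (U k) (hUfin k) (hU k)
  let g := fun k => Classical.choice (hi₀ k)
  let i : κ → I := fun k => ⟨i₀ k, Module.Finite.equiv (g k)⟩
  let s : Z →ₗ[Γ] N.TensorObj (M.TensorObj Z) := (σ.app Z).hom
  let r : N.TensorObj (M.TensorObj Z) →ₗ[Γ] Z := (ρ.app Z).hom
  have hrs : ∀ z, r (s z) = z :=
    LinearMap.congr_fun (congrArg (fun f : Z ⟶ Z => f.hom) (NatTrans.congr_app hσρ Z))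
  let A : ∀ k : Σ k : κ, ι (i k), Z →ₗ[Γ] T (i k.1) k.2 := fun k =>
    a (i k.1) k.2 ∘ₗ N.tensorMap ((g k.1).toLinearMap ∘ₗ c k.1) ∘ₗ s
  let B : ∀ k : Σ k : κ, ι (i k), T (i k.1) k.2 →ₗ[Γ] Z := fun k =>
    r ∘ₗ N.tensorMap (d k.1 ∘ₗ (g k.1).symm.toLinearMap) ∘ₗ b (i k.1) k.2
  have hAB : ∑ k, B k ∘ₗ A k = LinearMap.id := by
    refine LinearMap.ext fun z => ?_
    let t : N.TensorObj (M.TensorObj Z) := s z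
    have h2 : ∀ k, ∑ l, b (i k) l (a (i k) l (N.tensorMap ((g k).toLinearMap ∘ₗ c k) t)) =
        N.tensorMap ((g k).toLinearMap ∘ₗ c k) t := fun k => by
      have := LinearMap.congr_fun (hs (i k)) (N.tensorMap ((g k).toLinearMap ∘ₗ c k) t)
      rwa [LinearMap.sum_apply] at this
    have h3 : ∀ k, N.tensorMap (d k ∘ₗ (g k).symm.toLinearMap)
        (N.tensorMap ((g k).toLinearMap ∘ₗ c k) t) = N.tensorMap (d k ∘ₗ c k) t := fun k => by
      induction t using Bimodule.tensorObj_induction with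
      | h0 => simp
      | ht n v => simp
      | ha x y hx hy => simp only [map_add, hx, hy]
    have h4 : ∑ k, N.tensorMap (d k ∘ₗ c k) t = t := by
      induction t using Bimodule.tensorObj_induction with
      | h0 => simp
      | ht n v =>
        have := congrArg (N.tmul n) (LinearMap.congr_fun hsum v)
        simpa [LinearMap.sum_apply] using this
      | ha x y hx hy => simp only [map_add, Finset.sum_add_distrib, hx, hy]
    calc (∑ k, B k ∘ₗ A k) z
        = ∑ k, ∑ l, r (N.tensorMap (d k ∘ₗ (g k).symm.toLinearMap)
            (b (i k) l (a (i k) l (N.tensorMap ((g k).toLinearMap ∘ₗ c k) t)))) := by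
          rw [LinearMap.sum_apply, Fintype.sum_sigma]
          rfl
      _ = ∑ k, r (N.tensorMap (d k ∘ₗ c k) t) := by
          refine Finset.sum_congr rfl fun k _ => ?_
          rw [← map_sum, ← map_sum, h2, h3]
      _ = z := by
          rw [← map_sum, h4]
          exact hrs z
  obtain ⟨k, hk⟩ := exists_linearEquiv_of_sum (fun k : Σ k : κ, ι (i k) => T (i k.1) k.2)
    (fun k => hT _ _) A B hAB
  refine ⟨e ⟨i k.1, k.2⟩, ?_⟩
  change Nonempty (Z ≃ₗ[Γ] T (e.symm (e ⟨i k.1, k.2⟩)).1 (e.symm (e ⟨i k.1, k.2⟩)).2)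
  rw [e.symm_apply_apply]
  exact hk

theorem isArtinianRing_endAlg (R : Type u) [CommRing R] [IsArtinianRing R] [Algebra R Λ]
    [Module.Finite R Λ] (V : Type u) [AddCommGroup V] [Module Λ V] [Module.Finite Λ V] :
    IsArtinianRing (EndAlg Λ V) := by
  let _ := Module.compHom V (algebraMap R Λ)
  have : IsScalarTower R Λ V := IsScalarTower.of_algebraMap_smul fun _ _ => rfl
  have : Module.Finite R V := Module.Finite.trans Λ V
  have : Module.Finite R (Module.End Λ V) := finite_linearMap
  have : Module.Finite R (EndAlg Λ V) := Module.Finite.equiv (opLinearEquiv R)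
  exact IsArtinianRing.of_finite R _

theorem IsFrobeniusFinite.of_symmSepEquiv {R : Type u} [CommRing R] [IsArtinianRing R]
    [Algebra R Λ] [Module.Finite R Λ] [Algebra R Γ] [Module.Finite R Γ]
    (h : SymmSepEquiv Λ Γ) (hΛ : IsFrobeniusFinite R Λ) : IsFrobeniusFinite R Γ := by
  obtain ⟨M, N, h⟩ := h
  obtain ⟨V, hV, hfin⟩ := hΛ
  obtain ⟨W, hW⟩ := exists_isStpGenerator Γ R
  have := hV.1
  have := hW.1
  have := isArtinianRing_endAlg R (Λ := Λ) V
  have := isArtinianRing_endAlg R (Λ := Γ) W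
  exact ⟨W, hW, hfin.of_symmSepEquiv
    ⟨_, _, h.homBimodule (h.inAdd hV hW) (h.symm.inAdd hW hV)⟩⟩

end Transfer

end SepEq

theorem theorem3p4 {R : Type u} [CommRing R] [IsArtinianRing R]
    {Λ Γ : Type u} [Ring Λ] [Algebra R Λ] [Module.Finite R Λ]
    [Ring Γ] [Algebra R Γ] [Module.Finite R Γ]
    (h : SepEq.SymmSepEquiv Λ Γ) :
    (∃ V : ModuleCat.{u} Λ, SepEq.IsStpGenerator R Λ V) ∧
    (∃ W : ModuleCat.{u} Γ, SepEq.IsStpGenerator R Γ W) ∧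
    (∀ (V W : Type u) [AddCommGroup V] [Module Λ V] [Module R V] [IsScalarTower R Λ V]
      [AddCommGroup W] [Module Γ W] [Module R W] [IsScalarTower R Γ W],
      SepEq.IsStpGenerator R Λ V → SepEq.IsStpGenerator R Γ W →
        SepEq.SymmSepEquiv (SepEq.EndAlg Λ V) (SepEq.EndAlg Γ W) ∧
        (SepEq.SymmSepEquivOver R Λ Γ →
          SepEq.SymmSepEquivOver R (SepEq.EndAlg Λ V) (SepEq.EndAlg Γ W))) ∧
    (SepEq.IsFrobeniusFinite R Λ ↔ SepEq.IsFrobeniusFinite R Γ) := by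
  obtain ⟨M, N, hMN⟩ := h
  refine ⟨SepEq.exists_isStpGenerator Λ R, SepEq.exists_isStpGenerator Γ R, ?_,
    fun hΛ => hΛ.of_symmSepEquiv ⟨M, N, hMN⟩, fun hΓ => hΓ.of_symmSepEquiv ⟨N, M, hMN.symm⟩⟩
  intro V W _ _ _ _ _ _ _ _ hV hW
  refine ⟨⟨_, _, hMN.homBimodule (hMN.inAdd hV hW) (hMN.symm.inAdd hW hV)⟩, ?_⟩
  rintro ⟨M', N', h', hM', hN'⟩
  exact ⟨_, _, h'.homBimodule (h'.inAdd hV hW) (h'.symm.inAdd hW hV),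
    SepEq.isCentralOver_homBimodule hM' V W, SepEq.isCentralOver_homBimodule hN' W V⟩
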